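/- Let $d \ge 1$, let $A \in GL_d(\mathbb{Q})$ be a matrix none of whose complex eigenvalues has modulus $1$, and let $H \subset \mathbb{Q}^d$ be an additive subgroup with $A H = H$ and $\mathrm{rank}_{\mathbb{Q}}(H) = d$ (that is, $H$ spans $\mathbb{Q}^d$ over $\mathbb{Q}$). Let $G = \mathbb{Z} \ltimes_A H$ be the corresponding subgroup of $\mathbb{Z} \ltimes_A \mathbb{Q}^d$, in which the generator $a$ of $\mathbb{Z}$ satisfies $a b a^{-1} = A b$ for all $b \in H$. Assume that $G$ acts by orientation-preserving homeomorphisms of $[0,1]$ and that no point of $(0,1)$ is fixed by all of $G$. If the subgroup $H$ acts nontrivially but has a global fixed point in $(0,1)$ (a point of $(0,1)$ fixed by every element of $H$), then the action of $G$ is not by $C^1$ diffeomorphisms of $[0,1]$: at least one element of $G$ acts by a homeomorphism that is not a $C^1$ diffeomorphism. -/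

import Mathlib

open scoped Matrix MatrixGroups

/-- The automorphism `v ↦ A v` of the (multiplicatively written) group `ℚ ^ d`. -/
def matAut {d : ℕ} (A : GL (Fin d) ℚ) : MulAut (Multiplicative (Fin d → ℚ)) where
  toFun v := .ofAdd ((A : Matrix (Fin d) (Fin d) ℚ) *ᵥ v.toAdd)
  invFun v := .ofAdd (((A⁻¹ : GL (Fin d) ℚ) : Matrix (Fin d) (Fin d) ℚ) *ᵥ v.toAdd)
  left_inv v := by
    simp only [toAdd_ofAdd, Matrix.mulVec_mulVec, Units.inv_mul, Matrix.one_mulVec, ofAdd_toAdd]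
  right_inv v := by
    simp only [toAdd_ofAdd, Matrix.mulVec_mulVec, Units.mul_inv, Matrix.one_mulVec, ofAdd_toAdd]
  map_mul' v w := by
    simp only [toAdd_mul, Matrix.mulVec_add, ofAdd_add]

/-- The group `ℤ ⋉_A ℚ ^ d`, in which the generator `a` of `ℤ` satisfies `a v a⁻¹ = A v`. -/
abbrev AffineQ {d : ℕ} (A : GL (Fin d) ℚ) : Type :=
  Multiplicative (Fin d → ℚ) ⋊[zpowersHom _ (matAut A)] Multiplicative ℤ

/-- The additive subgroup `H` of `ℚ ^ d` satisfies `A H = H`. -/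
def IsInvariantUnder {d : ℕ} (A : GL (Fin d) ℚ) (H : AddSubgroup (Fin d → ℚ)) : Prop :=
  ∀ v : Fin d → ℚ, (A : Matrix (Fin d) (Fin d) ℚ) *ᵥ v ∈ H ↔ v ∈ H

theorem zpowersHom_matAut_mem_iff {d : ℕ} {A : GL (Fin d) ℚ} {H : AddSubgroup (Fin d → ℚ)}
    (hH : IsInvariantUnder A H) (k : Multiplicative ℤ) (v : Multiplicative (Fin d → ℚ)) :
    (zpowersHom _ (matAut A) k v).toAdd ∈ H ↔ v.toAdd ∈ H := by
  have h1 : ∀ w : Multiplicative (Fin d → ℚ), (matAut A w).toAdd ∈ H ↔ w.toAdd ∈ H :=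
    fun w => hH w.toAdd
  have h2 : ∀ (n : ℕ) (w : Multiplicative (Fin d → ℚ)),
      ((matAut A ^ n) w).toAdd ∈ H ↔ w.toAdd ∈ H := by
    intro n
    induction n with
    | zero => intro w; simp
    | succ n ih => intro w; rw [pow_succ, MulAut.mul_apply, ih, h1]
  rw [zpowersHom_apply]
  obtain ⟨n, hn | hn⟩ := Int.eq_nat_or_neg k.toAdd
  · rw [hn, zpow_natCast, h2]
  · rw [hn, zpow_neg, zpow_natCast, ← h2 n ((matAut A ^ n)⁻¹ v), MulAut.apply_inv_self]

/-- The subgroup `ℤ ⋉_A H` of `ℤ ⋉_A ℚ ^ d`, for an `A`-invariant subgroup `H` of `ℚ ^ d`. -/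
def semidirectSubgroup {d : ℕ} (A : GL (Fin d) ℚ) (H : AddSubgroup (Fin d → ℚ))
    (hH : IsInvariantUnder A H) : Subgroup (AffineQ A) where
  carrier := {g | g.left.toAdd ∈ H}
  one_mem' := H.zero_mem
  mul_mem' {g g'} hg hg' :=
    H.add_mem hg ((zpowersHom_matAut_mem_iff hH g.right g'.left).2 hg')
  inv_mem' {g} hg :=
    (zpowersHom_matAut_mem_iff hH g.right⁻¹ g.left⁻¹).2 (H.neg_mem hg)

/-- `H` as a subgroup of `ℤ ⋉_A H`: the elements whose `ℤ`-component is trivial. -/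
def abelianPart {d : ℕ} (A : GL (Fin d) ℚ) (H : AddSubgroup (Fin d → ℚ))
    (hH : IsInvariantUnder A H) : Subgroup (semidirectSubgroup A H hH) :=
  (SemidirectProduct.rightHom.comp (semidirectSubgroup A H hH).subtype).ker

/-- The `ℚ`-rank of a subgroup `H` of `ℚ ^ d`. -/
noncomputable def rankQ {d : ℕ} (H : AddSubgroup (Fin d → ℚ)) : ℕ :=
  Module.finrank ℚ (Submodule.span ℚ (H : Set (Fin d → ℚ)))

/-- No complex eigenvalue of `A` has modulus `1`. -/
def NoEigenvalueOfNormOne {d : ℕ} (A : GL (Fin d) ℚ) : Prop :=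
  ∀ μ : ℂ, Module.End.HasEigenvalue
    (Matrix.toLin' ((A : Matrix (Fin d) (Fin d) ℚ).map (algebraMap ℚ ℂ))) μ → ‖μ‖ ≠ 1

/-- A self-map of `[0,1]` is of class `C¹` (with one-sided derivatives at the endpoints). -/
def IsC1Map (f : unitInterval → unitInterval) : Prop :=
  ContDiffOn ℝ 1 (fun x : ℝ => (f (Set.projIcc 0 1 zero_le_one x) : ℝ)) (Set.Icc 0 1)

/-- A homeomorphism of `[0,1]` is a `C¹` diffeomorphism. -/
def IsC1Diffeo (f : unitInterval ≃ₜ unitInterval) : Prop :=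
  IsC1Map f ∧ IsC1Map f.symm

/-- The point `x` is fixed by all elements of `K` under the action `φ`. -/
def IsGlobalFixedPoint {G : Type*} [Group G] (φ : G →* (unitInterval ≃ₜ unitInterval))
    (K : Subgroup G) (x : unitInterval) : Prop :=
  ∀ g ∈ K, φ g x = x

/-! Suppose the action is `C¹`. Let `(u,v)` be a component of the complement of the common fixed set
of `H`, and let `x` lie in it. As `H` is abelian of finite rank, some element has no fixed point in
`(u,v)`, and translation numbers yield a nonzero functional `t` such that `h` moves `x` to the right
whenever `⟨h,t⟩ > 0` (`exists_translation_functional`). The generator `a` permutes the common fixed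
points of `H` and fixes none in `(0,1)`; up to exchanging `a` and its inverse, `a` pushes `(u,v)` to
`1` and its inverse pushes it to `0` (`tendsto_iterate_of_no_common_fixed`).

Let `c` be either endpoint, `α` the map contracting towards it, `lam` its derivative at `c`. The
points `αⁿ u` are fixed by `H` and accumulate at `c`, so all of `H` is tangent to the identity
there. Displacements near `c` are then additive to first order and are encoded by a vector `δ(y)`
(`displacement_sub_ratPairing_isLittleO`) with `δ(α y) ≈ lam • δ(y) R`, where `R` is the matrix of
the conjugation (`displacementVec_conj_isLittleO`). On `αⁿ(u,v)` the translation functional is `Tₙ =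
t Rⁿ`, and comparing signs makes `δ(αⁿ x)` asymptotically parallel to `Tₙ`. So `‖δ(αⁿ x)‖ / ‖Tₙ‖` is
multiplied by `lam` in the limit at each step, and so is the length `Lₙ` of `αⁿ(u,v)`. Since `‖δ(αⁿ
x)‖ ≤ Lₙ`, `‖Tₙ‖` is at most `Lₙ ‖Tₙ‖ / ‖δ(αⁿ x)‖`, whose successive ratios tend to `1`: it grows
subexponentially (`subexponential_of_contraction`).

The two endpoints give this for the same `t` under `A` and under `A⁻¹`. The vectors with both
properties form an invariant subspace, on which every eigenvalue has modulus one
(`eq_zero_of_subexponential_orbit`); hence `t = 0`, a contradiction. -/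

/-! ### Translation numbers of abelian groups of increasing maps. -/

section TranslationNumber

open Filter Topology

/-- Homogenisation of an integer-valued quasimorphism on an abelian group. -/
theorem exists_addMonoidHom_of_quasimorphism {H : Type*} [AddCommGroup H] (f : H → ℤ)
    (hle : ∀ h k, f h + f k ≤ f (h + k)) (hge : ∀ h k, f (h + k) ≤ f h + f k + 1) :
    ∃ τ : H →+ ℝ, ∀ h, (f h : ℝ) ≤ τ h ∧ τ h ≤ f h + 1 := by
  have up : ∀ (n : ℕ) (h : H), f (n • h) ≤ n * (f h + 1) := by
    intro n h
    induction n with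
    | zero => have := hle 0 0; simp only [add_zero] at this; simp; omega
    | succ n ih =>
      have := hge (n • h) h
      rw [succ_nsmul]; push_cast; linarith
  -- Only positive multiples: the hypotheses allow `f 0 = -1`.
  have low : ∀ (n : ℕ) (h : H), (n + 1 : ℕ) * f h ≤ f ((n + 1) • h) := by
    intro n h
    induction n with
    | zero => simp
    | succ n ih =>
      have := hle ((n + 1) • h) h
      rw [succ_nsmul]; push_cast at ih ⊢; linarith
  have hlim : ∀ h : H, ∃ l : ℝ, Tendsto (fun n : ℕ => (f (n • h) : ℝ) / n) atTop (𝓝 l) := by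
    intro h
    -- Fekete's lemma gives the limit.
    have hsub : Subadditive (fun n : ℕ => -(f (n • h) : ℝ)) := by
      intro m n
      have := hle (m • h) (n • h)
      simp only [add_nsmul]
      have h' : ((f (m • h) : ℝ) + f (n • h)) ≤ f (m • h + n • h) := by exact_mod_cast this
      linarith
    have hbdd : BddBelow (Set.range fun n : ℕ => -(f (n • h) : ℝ) / n) := by
      refine ⟨-|(f h + 1 : ℝ)|, ?_⟩
      rintro _ ⟨n, rfl⟩
      rcases Nat.eq_zero_or_pos n with rfl | hn
      · simp
      · have hn' : (0 : ℝ) < n := by exact_mod_cast hn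
        have := up n h
        have h' : (f (n • h) : ℝ) ≤ n * (f h + 1) := by exact_mod_cast this
        simp only
        rw [le_div_iff₀ hn']
        nlinarith [le_abs_self (f h + 1 : ℝ)]
    refine ⟨-hsub.lim, ?_⟩
    have := (hsub.tendsto_lim hbdd).neg
    refine this.congr fun n => ?_
    ring
  choose l hl using hlim
  have hinv : Tendsto (fun n : ℕ => 1 / (n : ℝ)) atTop (𝓝 0) := tendsto_one_div_atTop_nhds_zero_nat
  -- The defect of `f` lies in `[0,1]` and disappears after division by `n`.
  have hladd : ∀ h k, l (h + k) = l h + l k := by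
    intro h k
    have h1 := (hl (h + k)).sub ((hl h).add (hl k))
    have h2 : Tendsto (fun n : ℕ => (f (n • (h + k)) : ℝ) / n - (f (n • h) / n + f (n • k) / n))
        atTop (𝓝 0) := by
      refine tendsto_of_tendsto_of_tendsto_of_le_of_le tendsto_const_nhds hinv ?_ ?_
      · intro n
        have h' : ((f (n • h) : ℝ) + f (n • k)) ≤ f (n • h + n • k) := by
          exact_mod_cast hle (n • h) (n • k)
        simp only [nsmul_add]
        rw [← add_div, ← sub_div]
        exact div_nonneg (by linarith) (Nat.cast_nonneg n)
      · intro n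
        have h' : (f (n • h + n • k) : ℝ) ≤ f (n • h) + f (n • k) + 1 := by
          exact_mod_cast hge (n • h) (n • k)
        simp only [nsmul_add]
        rw [← add_div, ← sub_div]
        exact div_le_div_of_nonneg_right (by linarith) (Nat.cast_nonneg n)
    have := tendsto_nhds_unique h1 h2
    linarith
  refine ⟨AddMonoidHom.mk' l hladd, fun h => ⟨?_, ?_⟩⟩
  · refine ge_of_tendsto (hl h) ?_
    filter_upwards [eventually_gt_atTop 0] with n hn
    obtain ⟨m, rfl⟩ : ∃ m, n = m + 1 := ⟨n - 1, by omega⟩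
    have hn' : (0 : ℝ) < (m + 1 : ℕ) := by exact_mod_cast hn
    rw [le_div_iff₀ hn', mul_comm]
    exact_mod_cast low m h
  · refine le_of_tendsto (hl h) ?_
    filter_upwards [eventually_gt_atTop 0] with n hn
    have hn' : (0 : ℝ) < n := by exact_mod_cast hn
    rw [div_le_iff₀ hn', mul_comm]
    exact_mod_cast up n h

/-- The translation number homomorphism of an abelian group of increasing maps of an invariant
set `S`, one of whose elements moves points of `S` cofinally and coinitially. -/
theorem exists_translation_hom {X H : Type*} [LinearOrder X] [AddCommGroup H] {ρ : H → X → X}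
    (hzero : ∀ y, ρ 0 y = y) (hadd : ∀ h k y, ρ (h + k) y = ρ h (ρ k y))
    (hmono : ∀ h, StrictMono (ρ h)) {S : Set X} (hS : ∀ h, ∀ y ∈ S, ρ h y ∈ S) {b : H} {x : X}
    (hx : x ∈ S) (hbx : x < ρ b x) (hcof : ∀ y ∈ S, ∃ n : ℤ, y < ρ (n • b) x)
    (hcoi : ∀ y ∈ S, ∃ n : ℤ, ρ (n • b) x < y) :
    ∃ τ : H →+ ℝ, 0 < τ b ∧ ∀ h, 0 < τ h → ∀ y ∈ S, y < ρ h y := by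
  have hcomm : ∀ h k y, ρ h (ρ k y) = ρ k (ρ h y) := fun h k y => by
    rw [← hadd, add_comm, hadd]
  have hstep : ∀ n : ℤ, ρ (n • b) x < ρ ((n + 1) • b) x := fun n => by
    rw [add_smul, one_smul, hadd]
    exact hmono _ hbx
  have hs : StrictMono fun n : ℤ => ρ (n • b) x := strictMono_int_of_lt_succ hstep
  -- The `b`-orbit of `x` is a ladder, and `f h` is the last rung not above `ρ h x`. Like an integer
  -- part, it has defect `0` or `1` because the action is commutative.
  have hf : ∀ h, ∃ m : ℤ, ρ (m • b) x ≤ ρ h x ∧ ρ h x < ρ ((m + 1) • b) x := by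
    intro h
    obtain ⟨n, hn⟩ := hcof _ (hS h x hx)
    obtain ⟨k, hk⟩ := hcoi _ (hS h x hx)
    obtain ⟨m, hm, hm'⟩ := Int.exists_greatest_of_bdd (P := fun m => ρ (m • b) x ≤ ρ h x)
      ⟨n, fun z hz => hs.le_iff_le.1 (hz.trans hn.le)⟩ ⟨k, hk.le⟩
    exact ⟨m, hm, not_le.1 fun hc => by have := hm' _ hc; omega⟩
  choose f hf1 hf2 using hf
  have key1 : ∀ h (m : ℤ), ρ (m • b) x ≤ ρ h x → m ≤ f h := fun h m hm => by
    have := hs.lt_iff_lt.1 (hm.trans_lt (hf2 h)); omega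
  have key2 : ∀ h (m : ℤ), ρ h x < ρ ((m + 1) • b) x → f h ≤ m := fun h m hm => by
    have := hs.lt_iff_lt.1 ((hf1 h).trans_lt hm); omega
  obtain ⟨τ, hτ⟩ := exists_addMonoidHom_of_quasimorphism f
    (fun h k => key1 _ _ (by
      rw [add_smul, hadd, hadd]
      calc ρ (f h • b) (ρ (f k • b) x) ≤ ρ (f h • b) (ρ k x) := (hmono _).monotone (hf1 k)
        _ = ρ k (ρ (f h • b) x) := hcomm _ _ _
        _ ≤ ρ k (ρ h x) := (hmono _).monotone (hf1 h)
        _ = ρ h (ρ k x) := hcomm _ _ _))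
    (fun h k => key2 _ _ (by
      rw [show f h + f k + 1 + 1 = (f h + 1) + (f k + 1) by ring, add_smul, hadd, hadd]
      calc ρ h (ρ k x) < ρ h (ρ ((f k + 1) • b) x) := hmono _ (hf2 k)
        _ = ρ ((f k + 1) • b) (ρ h x) := hcomm _ _ _
        _ < ρ ((f k + 1) • b) (ρ ((f h + 1) • b) x) := hmono _ (hf2 h)
        _ = _ := hcomm _ _ _))
  refine ⟨τ, ?_, ?_⟩
  · have h1 : 1 ≤ f b := key1 b 1 (by simp)
    have h2 : (1 : ℝ) ≤ f b := by exact_mod_cast h1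
    linarith [(hτ b).1]
  · intro h hh y hy
    obtain ⟨k, hk⟩ := hcof y hy
    obtain ⟨j, hj⟩ := hcoi y hy
    -- `y` lies between rungs `j` and `k`. The extra `1` absorbs the gap between `τ` and `f`, so `n
    -- • h` climbs at least `k - j` rungs and moves `y` to the right; then so does `h`.
    obtain ⟨n, hn⟩ := exists_nat_gt (((k : ℝ) - j + 1) / τ h)
    rw [div_lt_iff₀ hh] at hn
    have h1 : k - j ≤ f (n • h) := by
      have := (hτ (n • h)).2
      rw [map_nsmul, nsmul_eq_mul] at this
      have h2 : ((k - j : ℤ) : ℝ) < f (n • h) := by push_cast; linarith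
      exact_mod_cast h2.le
    have h2 : y < ρ (n • h) y := by
      calc y < ρ (k • b) x := hk
        _ ≤ ρ ((j + f (n • h)) • b) x := hs.monotone (by omega)
        _ = ρ (j • b) (ρ (f (n • h) • b) x) := by rw [add_smul, hadd]
        _ ≤ ρ (j • b) (ρ (n • h) x) := (hmono _).monotone (hf1 _)
        _ = ρ (n • h) (ρ (j • b) x) := hcomm _ _ _
        _ < ρ (n • h) y := hmono _ hj
    by_contra! hc
    refine absurd h2 (not_lt.2 ?_)
    clear hn h1 h2
    induction n with
    | zero => simp [hzero]
    | succ n ih =>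
      rw [succ_nsmul, hadd]
      exact ((hmono _).monotone hc).trans ih

end TranslationNumber

/-! ### Linear algebra: vectors with subexponential orbits. -/

section SubexponentialOrbits

open Filter Topology

/-- If `M` and `N` are inverse to each other and `M` has no eigenvalue of modulus one, then no
nonzero vector has subexponential growth under both `M` and `N`. -/
theorem eq_zero_of_subexponential_orbit {V : Type*} [NormedAddCommGroup V] [NormedSpace ℂ V]
    [FiniteDimensional ℂ V] {M N : Module.End ℂ V}
    (hNM : ∀ v, N (M v) = v)
    (hM : ∀ μ, M.HasEigenvalue μ → ‖μ‖ ≠ 1) {v : V}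
    (h1 : ∀ r : ℝ, 1 < r → ∃ K, ∀ n : ℕ, ‖(M ^ n) v‖ ≤ K * r ^ n)
    (h2 : ∀ r : ℝ, 1 < r → ∃ K, ∀ n : ℕ, ‖(N ^ n) v‖ ≤ K * r ^ n) : v = 0 := by
  -- Quantifying over all `r > 1` yields a subspace to which an eigenvector argument applies.
  let G : Module.End ℂ V → Submodule ℂ V := fun T =>
    { carrier := {w | ∀ r : ℝ, 1 < r → ∃ K, ∀ n : ℕ, ‖(T ^ n) w‖ ≤ K * r ^ n}
      zero_mem' := fun r _ => ⟨0, fun n => by simp⟩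
      add_mem' := by
        intro a b ha hb r hr
        obtain ⟨K, hK⟩ := ha r hr
        obtain ⟨L, hL⟩ := hb r hr
        refine ⟨K + L, fun n => ?_⟩
        rw [map_add, add_mul]
        exact (norm_add_le _ _).trans (add_le_add (hK n) (hL n))
      smul_mem' := by
        intro c a ha r hr
        obtain ⟨K, hK⟩ := ha r hr
        refine ⟨‖c‖ * K, fun n => ?_⟩
        rw [map_smul, norm_smul, mul_assoc]
        exact mul_le_mul_of_nonneg_left (hK n) (norm_nonneg _) }
  have hstab : ∀ T T' : Module.End ℂ V, (∀ w, T' (T w) = w) → ∀ w, w ∈ G T → w ∈ G T' →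
      T w ∈ G T ∧ T w ∈ G T' := by
    intro T T' hT w hw hw'
    refine ⟨fun r hr => ?_, fun r hr => ?_⟩
    · obtain ⟨K, hK⟩ := hw r hr
      refine ⟨K * r, fun n => ?_⟩
      have := hK (n + 1)
      rw [pow_succ, Module.End.mul_apply] at this
      rw [mul_assoc, ← pow_succ']
      exact this
    · obtain ⟨K, hK⟩ := hw' r hr
      -- For `n > 0` one application of `T'` cancels `T`; the term `‖T w‖` covers `n = 0`.
      refine ⟨max K ‖T w‖, fun n => ?_⟩
      have hr0 : (0 : ℝ) < r := by linarith
      cases n with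
      | zero => simp
      | succ n =>
        rw [pow_succ, Module.End.mul_apply, hT]
        calc ‖(T' ^ n) w‖ ≤ K * r ^ n := hK n
          _ ≤ max K ‖T w‖ * r ^ (n + 1) := by
            gcongr
            · exact le_max_left _ _
            · exact hr.le
            · omega
  let W : Submodule ℂ V := G M ⊓ G N
  have hW : ∀ w ∈ W, M w ∈ W := fun w hw => hstab M N hNM w hw.1 hw.2
  by_contra hv
  have hvW : v ∈ W := ⟨h1, h2⟩
  have : Nontrivial W := ⟨⟨⟨v, hvW⟩, 0, fun h => hv (congrArg Subtype.val h)⟩⟩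
  obtain ⟨μ, hμ⟩ := Module.End.exists_eigenvalue (M.restrict hW)
  obtain ⟨w, hw⟩ := hμ.exists_hasEigenvector
  have hw0 : (w : V) ≠ 0 := fun h => hw.2 (Subtype.ext h)
  have hMw : M w = μ • (w : V) := congrArg Subtype.val hw.apply_eq_smul
  have hμM : M.HasEigenvalue μ :=
    Module.End.hasEigenvalue_of_hasEigenvector (Module.End.hasEigenvector_iff.2
      ⟨Module.End.mem_eigenspace_iff.2 hMw, hw0⟩)
  have hwpos : 0 < ‖(w : V)‖ := norm_pos_iff.2 hw0
  have hMn : ∀ n : ℕ, (M ^ n) w = μ ^ n • (w : V) := by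
    intro n
    induction n with
    | zero => simp
    | succ n ih => rw [pow_succ, Module.End.mul_apply, hMw, map_smul, ih, smul_smul, ← pow_succ']
  have hNn : ∀ n : ℕ, μ ^ n • (N ^ n) w = (w : V) := by
    intro n
    induction n with
    | zero => simp
    | succ n ih =>
      have : μ • N w = (w : V) := by rw [← map_smul, ← hMw, hNM]
      rw [pow_succ, pow_succ, Module.End.mul_apply, mul_smul, ← map_smul, this, ih]
  -- Applied to `‖μ‖` and to `‖μ‖⁻¹`, so that `‖μ‖ = 1`.
  have growth : ∀ s : ℝ, 0 ≤ s → (∀ r : ℝ, 1 < r → ∃ K, ∀ n : ℕ, s ^ n * ‖(w : V)‖ ≤ K * r ^ n) →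
      s ≤ 1 := by
    intro s hs hK
    by_contra! hs1
    obtain ⟨r, hr1, hrs⟩ := exists_between hs1
    obtain ⟨K, hK⟩ := hK r hr1
    have hr0 : 0 < r := by linarith
    have ht := tendsto_pow_atTop_atTop_of_one_lt ((one_lt_div hr0).2 hrs)
    obtain ⟨n, hn⟩ := (ht.eventually_gt_atTop (K / ‖(w : V)‖)).exists
    rw [div_lt_iff₀ hwpos, div_pow, div_mul_eq_mul_div, lt_div_iff₀ (pow_pos hr0 n)] at hn
    exact absurd (hK n) (not_le.2 hn)
  refine hM μ hμM (le_antisymm (growth _ (norm_nonneg _) fun r hr => ?_) ?_)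
  · obtain ⟨K, hK⟩ := w.2.1 r hr
    refine ⟨K, fun n => ?_⟩
    have := hK n
    rwa [hMn, norm_smul, norm_pow] at this
  · have hμ0 : 0 < ‖μ‖ := by
      refine norm_pos_iff.2 fun h => hw0 ?_
      have := hNn 1
      simpa [h] using this.symm
    have := growth ‖μ‖⁻¹ (by positivity) fun r hr => by
      obtain ⟨K, hK⟩ := w.2.2 r hr
      refine ⟨K, fun n => ?_⟩
      have h3 := hK n
      have h4 := congrArg norm (hNn n)
      rw [norm_smul, norm_pow] at h4
      rw [← h4, inv_pow, inv_mul_cancel_left₀ (by positivity)]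
      exact h3
    rwa [inv_le_one₀ hμ0] at this

/-- Matrix version, for row vectors. -/
theorem eq_zero_of_subexponential_vecMul {d : ℕ} {A : GL (Fin d) ℚ}
    (hA : NoEigenvalueOfNormOne A) {t : Fin d → ℝ}
    (h1 : ∀ r : ℝ, 1 < r → ∃ K, ∀ n : ℕ,
      ‖t ᵥ* ((A : Matrix (Fin d) (Fin d) ℚ).map (algebraMap ℚ ℝ)) ^ n‖ ≤ K * r ^ n)
    (h2 : ∀ r : ℝ, 1 < r → ∃ K, ∀ n : ℕ,
      ‖t ᵥ* (((A⁻¹ : GL (Fin d) ℚ) : Matrix (Fin d) (Fin d) ℚ).map (algebraMap ℚ ℝ)) ^ n‖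
        ≤ K * r ^ n) : t = 0 := by
  let c : Matrix (Fin d) (Fin d) ℚ → Matrix (Fin d) (Fin d) ℂ := fun B => B.map (algebraMap ℚ ℂ)
  let v : Fin d → ℂ := fun i => (t i : ℂ)
  have hpow : ∀ (B : Matrix (Fin d) (Fin d) ℚ) (n : ℕ),
      ‖(Matrix.toLin' (c B)ᵀ ^ n) v‖ = ‖t ᵥ* (B.map (algebraMap ℚ ℝ)) ^ n‖ := by
    intro B n
    have : (Matrix.toLin' (c B)ᵀ ^ n) v =
        fun i => ((t ᵥ* (B.map (algebraMap ℚ ℝ)) ^ n) i : ℂ) := by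
      induction n with
      | zero => simp [v]
      | succ n ih =>
        rw [pow_succ', Module.End.mul_apply, ih, pow_succ, ← Matrix.vecMul_vecMul]
        ext i
        simp [c, Matrix.mulVec_transpose, Matrix.vecMul, dotProduct]
    rw [this]
    simp [Pi.norm_def]
  have hinv : ∀ B C : Matrix (Fin d) (Fin d) ℚ, C * B = 1 → ∀ w,
      Matrix.toLin' (c B)ᵀ (Matrix.toLin' (c C)ᵀ w) = w := by
    intro B C h w
    simp only [Matrix.toLin'_apply, Matrix.mulVec_mulVec, ← Matrix.transpose_mul]
    have : c C * c B = 1 := by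
      simp only [c, ← Matrix.map_mul, h]
      simp
    simp [this]
  have hv : v = 0 := eq_zero_of_subexponential_orbit
    (M := Matrix.toLin' (c A)ᵀ) (N := Matrix.toLin' (c (A⁻¹ : GL (Fin d) ℚ))ᵀ)
    (hinv _ _ (by simp))
    -- Row vectors turn into the transpose, which has the same characteristic polynomial.
    (fun μ hμ => hA μ (by
      rw [Module.End.hasEigenvalue_iff_isRoot_charpoly, Matrix.charpoly_toLin'] at hμ ⊢
      rwa [Matrix.charpoly_transpose] at hμ))
    (fun r hr => by simpa only [hpow] using h1 r hr)
    (fun r hr => by simpa only [hpow] using h2 r hr)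
  ext i
  simpa [v] using congrFun hv i

end SubexponentialOrbits

/-! ### First-order behaviour of displacements near a common fixed point. -/

section Displacement

open Filter Topology Asymptotics

/-- Strict differentiability at `c` of a self-map of `[0,1]`, with derivative `D`. -/
def HasStrictSlopeAt (f : unitInterval → unitInterval) (c : unitInterval) (D : ℝ) : Prop :=
  (fun p : unitInterval × unitInterval => (f p.1 : ℝ) - f p.2 - D * ((p.1 : ℝ) - p.2))
    =o[𝓝 (c, c)] fun p => (p.1 : ℝ) - p.2

/-- The displacement `f y - y`. -/
def displacement (f : unitInterval → unitInterval) (y : unitInterval) : ℝ := (f y : ℝ) - y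

/-- The pairing of a rational vector with a real vector. -/
def ratPairing {d : ℕ} (v : Fin d → ℚ) (w : Fin d → ℝ) : ℝ := ∑ i, (v i : ℝ) * w i

theorem ratPairing_add {d : ℕ} (v v' : Fin d → ℚ) (w : Fin d → ℝ) :
    ratPairing (v + v') w = ratPairing v w + ratPairing v' w := by
  simp [ratPairing, add_mul, Finset.sum_add_distrib]

theorem ratPairing_neg {d : ℕ} (v : Fin d → ℚ) (w : Fin d → ℝ) :
    ratPairing (-v) w = -ratPairing v w := by
  simp [ratPairing]

theorem ratPairing_nsmul {d : ℕ} (n : ℕ) (v : Fin d → ℚ) (w : Fin d → ℝ) :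
    ratPairing (n • v) w = n * ratPairing v w := by
  simp [ratPairing, Finset.mul_sum, mul_assoc]

theorem ratPairing_smul_right {d : ℕ} (v : Fin d → ℚ) (c : ℝ) (w : Fin d → ℝ) :
    ratPairing v (c • w) = c * ratPairing v w := by
  simp only [ratPairing, Finset.mul_sum, Pi.smul_apply, smul_eq_mul]
  exact Finset.sum_congr rfl fun i _ => by ring

theorem ratPairing_single {d : ℕ} (i : Fin d) (q : ℚ) (w : Fin d → ℝ) :
    ratPairing (Pi.single i q) w = q * w i := by
  rw [ratPairing, Finset.sum_eq_single i]
  · simp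
  · intro j _ hj
    simp [hj]
  · simp

/-- Conjugation acts on `H` by columns, hence on functionals by rows; this is why the orbits studied
are those of row vectors. -/
theorem ratPairing_mulVec {d : ℕ} (C : Matrix (Fin d) (Fin d) ℚ) (v : Fin d → ℚ)
    (w : Fin d → ℝ) :
    ratPairing (C *ᵥ v) w = ratPairing v (w ᵥ* C.map (algebraMap ℚ ℝ)) := by
  simp only [ratPairing, Matrix.mulVec, Matrix.vecMul, dotProduct, Rat.cast_sum, Rat.cast_mul,
    Finset.sum_mul, Finset.mul_sum, Matrix.map_apply, eq_ratCast]
  rw [Finset.sum_comm]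
  exact Finset.sum_congr rfl fun i _ => Finset.sum_congr rfl fun j _ => by ring

theorem continuous_ratPairing {d : ℕ} (v : Fin d → ℚ) : Continuous (ratPairing v) := by
  unfold ratPairing
  fun_prop

theorem isBigO_ratPairing {d : ℕ} {ι : Type*} (l : Filter ι) (v : Fin d → ℚ) (w : ι → Fin d → ℝ) :
    (fun y => ratPairing v (w y)) =O[l] w := by
  unfold ratPairing
  have h : ∀ i, (fun y => (v i : ℝ) * w y i) =O[l] w := fun i =>
    IsBigO.const_mul_left (IsBigO.of_bound 1 (Eventually.of_forall fun y => by
      rw [one_mul]; exact norm_le_pi_norm (w y) i)) _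
  refine (IsBigO.sum (s := Finset.univ) fun i _ => h i).congr_left fun y => ?_
  simp

/-- Integer combinations of the vectors `M e_i` exhaust the rational vectors up to denominators. -/
theorem exists_nsmul_eq_sum_zsmul {d : ℕ} {H : AddSubgroup (Fin d → ℚ)} {M : ℕ} (hM : 0 < M)
    {e : Fin d → H} (he : ∀ i, (e i : Fin d → ℚ) = Pi.single i (M : ℚ)) (p : Fin d → ℚ) :
    ∃ N : ℕ, 0 < N ∧ ∃ z : Fin d → ℤ, N • p = ((∑ i, z i • e i : H) : Fin d → ℚ) := by
  have hz : ∀ i, ∃ z : ℤ, ((∏ j, (p j).den : ℕ) : ℚ) * p i = z := by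
    intro i
    obtain ⟨k, hk⟩ := Finset.dvd_prod_of_mem (fun j => (p j).den) (Finset.mem_univ i)
    refine ⟨k * (p i).num, ?_⟩
    rw [hk]
    push_cast
    rw [← Rat.mul_den_eq_num (p i)]
    ring
  choose z hz using hz
  refine ⟨M * ∏ j, (p j).den, Nat.mul_pos hM (Finset.prod_pos fun j _ => Rat.den_pos _), z, ?_⟩
  ext i
  simp only [AddSubgroup.val_finsetSum, AddSubgroup.coe_zsmul, he, Pi.smul_apply, Finset.sum_apply]
  rw [Finset.sum_eq_single i]
  · rw [Pi.single_eq_same, nsmul_eq_mul, zsmul_eq_mul, ← hz i]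
    push_cast
    ring
  · intro j _ hj
    simp [Pi.single_eq_of_ne (Ne.symm hj)]
  · simp

theorem IsLittleO.zero_left_of_eq {ι : Type*} {l : Filter ι} {d : ℕ} {f : ι → ℝ}
    {g : ι → Fin d → ℝ} (hf : ∀ y, f y = 0) : f =o[l] g := by
  have : f = fun _ => 0 := funext hf
  rw [this]
  exact isLittleO_zero _ _

/-- The vector of normalised displacements of the elements `e i` of `H`. -/
noncomputable def displacementVec {d : ℕ} {H : AddSubgroup (Fin d → ℚ)} (ρ : H → unitInterval → unitInterval)
    (M : ℕ) (e : Fin d → H) (y : unitInterval) : Fin d → ℝ :=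
  fun i => displacement (ρ (e i)) y / M

/-- Near a common fixed point where all elements of `H` are tangent to the identity, the
displacement is asymptotically linear. -/
theorem displacement_sub_ratPairing_isLittleO {d : ℕ} {H : AddSubgroup (Fin d → ℚ)}
    {ρ : H → unitInterval → unitInterval} {c : unitInterval}
    (hzero : ∀ y, ρ 0 y = y) (hadd : ∀ h k y, ρ (h + k) y = ρ h (ρ k y))
    (hcont : ∀ h, Continuous (ρ h)) (hc : ∀ h, ρ h c = c)
    (hs : ∀ h, HasStrictSlopeAt (ρ h) c 1)
    {M : ℕ} (hM : 0 < M) {e : Fin d → H} (he : ∀ i, (e i : Fin d → ℚ) = Pi.single i (M : ℚ))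
    (h : H) :
    (fun y => displacement (ρ h) y - ratPairing h (displacementVec ρ M e y))
      =o[𝓝 c] displacementVec ρ M e := by
  set δ := displacementVec ρ M e with hδ
  have hM' : (M : ℝ) ≠ 0 := by exact_mod_cast hM.ne'
  -- The expression equals `(ρ h (ρ k y) - ρ h y) - (ρ k y - y)`, so strict differentiability with
  -- slope `1` applies to the pair `(ρ k y, y)`.
  have add_o : ∀ h k, (fun y => displacement (ρ (h + k)) y - displacement (ρ h) y
      - displacement (ρ k) y) =o[𝓝 c] displacement (ρ k) := by
    intro h k
    have ht : Tendsto (fun y => (ρ k y, y)) (𝓝 c) (𝓝 (c, c)) := by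
      have : Continuous fun y => (ρ k y, y) := (hcont k).prodMk continuous_id
      simpa [hc] using this.tendsto c
    refine ((hs h).comp_tendsto ht).congr_left fun y => ?_
    simp only [Function.comp, displacement, hadd]
    ring
  have bigO : ∀ h : H, (fun y => displacement (ρ h) y - ratPairing h (δ y)) =o[𝓝 c] δ →
      displacement (ρ h) =O[𝓝 c] δ := by
    intro h hh
    refine (hh.isBigO.add (isBigO_ratPairing _ (h : Fin d → ℚ) δ)).congr_left fun y => ?_
    ring
  -- `P` contains the subgroup generated by the `e i`, where the claim holds with zero error, but
  -- that may be smaller than `H`: a multiple `N • h` is reached first, then divided by `N`.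
  let P : AddSubgroup H :=
    { carrier := {h | (fun y => displacement (ρ h) y - ratPairing h (δ y)) =o[𝓝 c] δ}
      zero_mem' := IsLittleO.zero_left_of_eq fun y => by
        simp [displacement, hzero, ratPairing]
      add_mem' := by
        intro h k hh hk
        refine ((((add_o h k).trans_isBigO (bigO k hk)).add hh).add hk).congr_left fun y => ?_
        rw [AddSubgroup.coe_add, ratPairing_add]
        ring
      neg_mem' := by
        intro h hh
        refine (((add_o (-h) h).trans_isBigO (bigO h hh)).add hh).neg_left.congr_left fun y => ?_
        simp only [neg_add_cancel, AddSubgroup.coe_neg, ratPairing_neg, displacement, hzero]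
        ring }
  have hPe : ∀ i, e i ∈ P := fun i => IsLittleO.zero_left_of_eq fun y => by
    rw [he, ratPairing_single, hδ]
    simp only [displacementVec, Rat.cast_natCast]
    field_simp
    ring
  have nsmul_o : ∀ (n : ℕ) (h : H), (fun y => displacement (ρ (n • h)) y
      - n * displacement (ρ h) y) =o[𝓝 c] displacement (ρ h) := by
    intro n h
    induction n with
    | zero =>
      refine (isLittleO_zero _ _).congr_left fun y => ?_
      simp [displacement, hzero]
    | succ n ih =>
      refine ((add_o (n • h) h).add ih).congr_left fun y => ?_
      rw [succ_nsmul]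
      push_cast
      ring
  obtain ⟨N, hN, z, hNz⟩ := exists_nsmul_eq_sum_zsmul hM he h
  have hN' : (N : ℝ) ≠ 0 := by exact_mod_cast hN.ne'
  have hPN : N • h ∈ P := by
    rw [show N • h = ∑ i, z i • e i from Subtype.ext (by rw [AddSubgroup.coe_nsmul, hNz])]
    exact sum_mem fun i _ => zsmul_mem (hPe i) _
  have hequiv : IsEquivalent (𝓝 c) (displacement (ρ (N • h)))
      (fun y => N * displacement (ρ h) y) :=
    (nsmul_o N h).trans_isBigO ((isBigO_refl _ _).const_mul_right hN')
  -- Needed before dividing: the error for `N • h` is measured against the displacement of `h`,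
  -- which must first be compared with `δ`.
  have hO : displacement (ρ h) =O[𝓝 c] δ :=
    (((isBigO_refl (displacement (ρ h)) (𝓝 c)).const_mul_right hN').trans
      hequiv.isBigO_symm).trans (bigO _ hPN)
  have h1 : (fun y => (N : ℝ) * (displacement (ρ h) y - ratPairing h (δ y))) =o[𝓝 c] δ := by
    refine (IsLittleO.sub hPN ((nsmul_o N h).trans_isBigO hO)).congr_left fun y => ?_
    rw [AddSubgroup.coe_nsmul, ratPairing_nsmul]
    ring
  exact (isLittleO_const_mul_left_iff hN').1 h1

/-- Transformation rule of the displacement vector under a map normalising the action. -/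
theorem displacementVec_conj_isLittleO {d : ℕ} {H : AddSubgroup (Fin d → ℚ)}
    {ρ : H → unitInterval → unitInterval} {c : unitInterval}
    (hcont : ∀ h, Continuous (ρ h)) (hc : ∀ h, ρ h c = c)
    {M : ℕ} (hM : 0 < M) {e : Fin d → H} (he : ∀ i, (e i : Fin d → ℚ) = Pi.single i (M : ℚ))
    (hlin : ∀ h : H, (fun y => displacement (ρ h) y - ratPairing h (displacementVec ρ M e y))
      =o[𝓝 c] displacementVec ρ M e)
    {α : unitInterval → unitInterval} {lam : ℝ} (hα : HasStrictSlopeAt α c lam)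
    {C : Matrix (Fin d) (Fin d) ℚ} {γ : H → H} (hγ : ∀ h, (γ h : Fin d → ℚ) = C *ᵥ h)
    (hconj : ∀ h y, α (ρ (γ h) y) = ρ h (α y)) :
    (fun y => displacementVec ρ M e (α y)
      - lam • (displacementVec ρ M e y ᵥ* C.map (algebraMap ℚ ℝ)))
      =o[𝓝 c] displacementVec ρ M e := by
  have hM' : (M : ℝ) ≠ 0 := by exact_mod_cast hM.ne'
  rw [isLittleO_pi]
  intro i
  set k := γ (e i) with hk
  have ht : Tendsto (fun y => (ρ k y, y)) (𝓝 c) (𝓝 (c, c)) := by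
    have : Continuous fun y => (ρ k y, y) := (hcont k).prodMk continuous_id
    simpa [hc] using this.tendsto c
  have hO : displacement (ρ k) =O[𝓝 c] displacementVec ρ M e := by
    refine ((hlin k).isBigO.add (isBigO_ratPairing _ (k : Fin d → ℚ) _)).congr_left fun y => ?_
    ring
  -- By `hconj`, `α` sends the pair `(ρ k y, y)` to `(ρ (e i) (α y), α y)`, so its slope relates the
  -- displacement of `k` at `y` to that of `e i` at `α y`.
  have h1 := (hα.comp_tendsto ht).trans_isBigO hO
  have h2 := (h1.add ((hlin k).const_mul_left lam)).const_mul_left (M : ℝ)⁻¹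
  refine h2.congr_left fun y => ?_
  rw [hk, hγ, ratPairing_mulVec, he, ratPairing_single]
  simp only [Function.comp, Pi.sub_apply, Pi.smul_apply, smul_eq_mul, displacement, hconj]
  rw [show displacementVec ρ M e (α y) i = (((ρ (e i) (α y) : unitInterval) : ℝ) - α y) / M from rfl]
  push_cast
  field_simp
  ring

end Displacement

/-! ### Directions and growth rates of sequences of vectors. -/

section Growth

open Filter Topology Asymptotics

/-- If rational functionals positive on `v` are nonnegative on `u`, and both vectors have
norm one, then `u = v`. -/
theorem eq_of_ratPairing_nonneg {d : ℕ} {u v : Fin d → ℝ} (hu : ‖u‖ = 1) (hv : ‖v‖ = 1)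
    (h : ∀ p : Fin d → ℚ, 0 < ratPairing p v → 0 ≤ ratPairing p u) : u = v := by
  have hreal : ∀ x : Fin d → ℝ, 0 < x ⬝ᵥ v → 0 ≤ x ⬝ᵥ u := by
    intro x hx
    have hd : DenseRange (Pi.map fun (_ : Fin d) (q : ℚ) => (q : ℝ)) :=
      DenseRange.piMap fun _ => Rat.denseRange_cast
    have hcv : Continuous fun x : Fin d → ℝ => x ⬝ᵥ v := by unfold dotProduct; fun_prop
    have hcu : Continuous fun x : Fin d → ℝ => x ⬝ᵥ u := by unfold dotProduct; fun_prop
    by_contra! hxu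
    have hopen : IsOpen {x : Fin d → ℝ | 0 < x ⬝ᵥ v ∧ x ⬝ᵥ u < 0} :=
      (isOpen_lt continuous_const hcv).inter (isOpen_lt hcu continuous_const)
    obtain ⟨p, hp1, hp2⟩ := hd.exists_mem_open hopen ⟨x, hx, hxu⟩
    exact absurd (h p hp1) (not_le.2 hp2)
  have hvv : 0 < v ⬝ᵥ v := by
    refine lt_of_le_of_ne (Finset.sum_nonneg fun i _ => mul_self_nonneg _) fun h0 => ?_
    rw [dotProduct_self_eq_zero.1 h0.symm] at hv
    simp at hv
  -- Pushing `x` slightly along `v` enters the open half-space. Using `-x` as well, `u` is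
  -- orthogonal to everything orthogonal to `v`, hence a multiple of `v`.
  have hnn : ∀ x : Fin d → ℝ, x ⬝ᵥ v = 0 → 0 ≤ x ⬝ᵥ u := by
    intro x hx
    have ht : Tendsto (fun s : ℝ => (x + s • v) ⬝ᵥ u) (𝓝[>] 0) (𝓝 (x ⬝ᵥ u)) := by
      have : Continuous fun s : ℝ => (x + s • v) ⬝ᵥ u := by unfold dotProduct; fun_prop
      simpa using (this.tendsto 0).mono_left nhdsWithin_le_nhds
    refine ge_of_tendsto ht ?_
    filter_upwards [self_mem_nhdsWithin] with s hs
    refine hreal _ ?_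
    rw [add_dotProduct, hx, zero_add, smul_dotProduct, smul_eq_mul]
    exact mul_pos hs hvv
  have hzero : ∀ x : Fin d → ℝ, x ⬝ᵥ v = 0 → x ⬝ᵥ u = 0 := by
    intro x hx
    have h1 := hnn x hx
    have h2 := hnn (-x) (by simp [hx])
    rw [neg_dotProduct] at h2
    linarith
  set c := (u ⬝ᵥ v) / (v ⬝ᵥ v) with hc
  have hperp : (u - c • v) ⬝ᵥ v = 0 := by
    rw [sub_dotProduct, smul_dotProduct, smul_eq_mul, hc, div_mul_cancel₀ _ hvv.ne', sub_self]
  have hself : (u - c • v) ⬝ᵥ (u - c • v) = 0 := by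
    rw [dotProduct_sub, hzero _ hperp, dotProduct_smul, hperp]
    simp
  have hucv : u = c • v := sub_eq_zero.1 (dotProduct_self_eq_zero.1 hself)
  have hc0 : 0 ≤ c := by
    refine div_nonneg ?_ hvv.le
    rw [dotProduct_comm]
    exact hreal v hvv
  have : c = 1 := by
    have := congrArg norm hucv
    rwa [norm_smul, hu, hv, mul_one, Real.norm_of_nonneg hc0, eq_comm] at this
  rw [hucv, this, one_smul]

/-- Two sequences of unit vectors get close to each other as soon as rational functionals that are
positive on the second one are asymptotically nonnegative on the first one. -/
theorem tendsto_sub_of_ratPairing {d : ℕ} {u v : ℕ → Fin d → ℝ} (hu : ∀ n, ‖u n‖ = 1)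
    (hv : ∀ n, ‖v n‖ = 1)
    (h : ∀ p : Fin d → ℚ, ∃ ε : ℕ → ℝ, Tendsto ε atTop (𝓝 0) ∧
      ∀ n, 0 < ratPairing p (v n) → -ε n ≤ ratPairing p (u n)) :
    Tendsto (fun n => u n - v n) atTop (𝓝 0) := by
  -- Along an ultrafilter both sequences converge on the compact unit sphere, and only their limits
  -- need comparison.
  refine (Filter.tendsto_iff_ultrafilter _ _ _).2 fun 𝒰 h𝒰 => ?_
  have hlim : ∀ w : ℕ → Fin d → ℝ, (∀ n, ‖w n‖ = 1) →
      ∃ a, ‖a‖ = 1 ∧ Tendsto w 𝒰 (𝓝 a) := by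
    intro w hw
    obtain ⟨a, ha, hle⟩ := (isCompact_sphere (0 : Fin d → ℝ) 1).ultrafilter_le_nhds (𝒰.map w)
      (le_principal_iff.2 (Filter.mem_map.2 (Filter.univ_mem' fun n => by simp [hw])))
    exact ⟨a, by simpa using ha, hle⟩
  obtain ⟨a, ha, hua⟩ := hlim u hu
  obtain ⟨b, hb, hvb⟩ := hlim v hv
  have hab : a = b := by
    refine eq_of_ratPairing_nonneg ha hb fun p hp => ?_
    obtain ⟨ε, hε, hpos⟩ := h p
    have h1 : Tendsto (fun n => ratPairing p (v n)) 𝒰 (𝓝 (ratPairing p b)) :=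
      ((continuous_ratPairing p).tendsto b).comp hvb
    have h2 : Tendsto (fun n => ratPairing p (u n)) 𝒰 (𝓝 (ratPairing p a)) :=
      ((continuous_ratPairing p).tendsto a).comp hua
    have h3 : Tendsto (fun n => -ε n) 𝒰 (𝓝 0) := by simpa using (hε.mono_left h𝒰).neg
    refine le_of_tendsto_of_tendsto h3 h2 ?_
    filter_upwards [h1.eventually_const_lt hp] with n hn
    exact hpos n hn
  simpa [hab] using hua.sub hvb

/-- A positive sequence with successive ratios tending to `1` grows subexponentially. -/
theorem exists_le_mul_pow_of_tendsto_ratio {K : ℕ → ℝ} (hK : ∀ n, 0 < K n)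
    (hlim : Tendsto (fun n => K (n + 1) / K n) atTop (𝓝 1)) {r : ℝ} (hr : 1 < r) :
    ∃ B, ∀ n, K n ≤ B * r ^ n := by
  have hr0 : 0 < r := by linarith
  obtain ⟨N, hN⟩ := eventually_atTop.1 (hlim.eventually_lt_const hr)
  have hstep : ∀ m, K (N + m) ≤ K N * r ^ m := by
    intro m
    induction m with
    | zero => simp
    | succ m ih =>
      have h1 := hN (N + m) (by omega)
      rw [div_lt_iff₀ (hK _)] at h1
      calc K (N + (m + 1)) ≤ r * K (N + m) := h1.le
        _ ≤ r * (K N * r ^ m) := by gcongr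
        _ = K N * r ^ (m + 1) := by ring
  refine ⟨∑ j ∈ Finset.range (N + 1), K j, fun n => ?_⟩
  have hle : ∀ j ≤ N, K j ≤ ∑ j ∈ Finset.range (N + 1), K j := fun j hj =>
    Finset.single_le_sum (f := K) (fun i _ => (hK i).le) (Finset.mem_range.2 (by omega))
  have hS : 0 ≤ ∑ j ∈ Finset.range (N + 1), K j := Finset.sum_nonneg fun i _ => (hK i).le
  rcases le_total n N with hn | hn
  · exact (hle n hn).trans (le_mul_of_one_le_right hS (one_le_pow₀ hr.le))
  · obtain ⟨m, rfl⟩ := Nat.exists_eq_add_of_le hn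
    calc K (N + m) ≤ K N * r ^ m := hstep m
      _ ≤ (∑ j ∈ Finset.range (N + 1), K j) * r ^ (N + m) := by
        gcongr
        · exact hle N le_rfl
        · exact hr.le
        · omega

/-- If `z` is asymptotically an orbit of `lam • Λ` and asymptotically parallel to the orbit `T`
of `Λ`, then the ratio of the norms of `z` and `T` is multiplied by `lam` asymptotically. -/
theorem tendsto_norm_ratio {V : Type*} [NormedAddCommGroup V] [NormedSpace ℝ V] {Λ : V →L[ℝ] V}
    {κ : ℝ} (hκ : 0 < κ) (hΛ : ∀ x, κ * ‖x‖ ≤ ‖Λ x‖) {lam : ℝ} (hlam : 0 ≤ lam) {z T : ℕ → V}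
    (hz : ∀ n, z n ≠ 0) (hT : ∀ n, T n ≠ 0) (hTs : ∀ n, T (n + 1) = Λ (T n))
    (hzs : (fun n => z (n + 1) - lam • Λ (z n)) =o[atTop] z)
    (hdir : Tendsto (fun n => ‖z n‖⁻¹ • z n - ‖T n‖⁻¹ • T n) atTop (𝓝 0)) :
    Tendsto (fun n => (‖z (n + 1)‖ / ‖T (n + 1)‖) / (‖z n‖ / ‖T n‖)) atTop (𝓝 lam) := by
  have hzp : ∀ n, 0 < ‖z n‖ := fun n => norm_pos_iff.2 (hz n)
  have hTp : ∀ n, 0 < ‖T n‖ := fun n => norm_pos_iff.2 (hT n)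
  set s : ℕ → ℝ := fun n => ‖T (n + 1)‖ / ‖T n‖ with hs
  have hsκ : ∀ n, κ ≤ s n := fun n => by
    rw [hs]
    simp only
    rw [le_div_iff₀ (hTp n), hTs]
    exact hΛ _
  have hnorm1 : Tendsto (fun n => ‖z n‖⁻¹ • (z (n + 1) - lam • Λ (z n))) atTop (𝓝 0) := by
    rw [tendsto_zero_iff_norm_tendsto_zero]
    refine (hzs.norm_norm.tendsto_div_nhds_zero).congr fun n => ?_
    rw [norm_smul, norm_inv, norm_norm, div_eq_inv_mul]
  have hnorm2 : Tendsto (fun n => lam • Λ (‖z n‖⁻¹ • z n - ‖T n‖⁻¹ • T n)) atTop (𝓝 0) := by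
    have h := ((Λ.continuous.tendsto 0).comp hdir).const_smul lam
    simpa using h
  -- After normalising by `‖z n‖`, the unit direction of `z n` may be replaced by that of `T n`
  -- inside `Λ`.
  have hsum : Tendsto (fun n => ‖z n‖⁻¹ • z (n + 1) - lam • (‖T n‖⁻¹ • T (n + 1))) atTop (𝓝 0) := by
    have h := hnorm1.add hnorm2
    rw [add_zero] at h
    refine h.congr fun n => ?_
    rw [map_sub, map_smul, map_smul, hTs, smul_sub, smul_sub, smul_comm lam ‖z n‖⁻¹]
    abel
  have hdiff : Tendsto (fun n => ‖z (n + 1)‖ / ‖z n‖ - lam * s n) atTop (𝓝 0) := by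
    refine squeeze_zero_norm (fun n => ?_) (tendsto_zero_iff_norm_tendsto_zero.1 hsum)
    refine le_trans (le_of_eq ?_) (abs_norm_sub_norm_le _ _)
    simp only [norm_smul, norm_inv, Real.norm_eq_abs, abs_of_nonneg hlam, abs_norm, hs]
    rw [div_eq_inv_mul, div_eq_inv_mul]
  -- The lower bound `κ ≤ s n` keeps the error small under this division.
  have hq : Tendsto (fun n => (‖z (n + 1)‖ / ‖z n‖ - lam * s n) / s n) atTop (𝓝 0) := by
    have h := hdiff.norm.div_const κ
    rw [norm_zero, zero_div] at h
    refine squeeze_zero_norm (fun n => ?_) h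
    have hsn : 0 < s n := hκ.trans_le (hsκ n)
    rw [norm_div, Real.norm_of_nonneg hsn.le]
    exact div_le_div_of_nonneg_left (norm_nonneg _) hκ (hsκ n)
  have h := hq.add_const lam
  rw [zero_add] at h
  refine h.congr fun n => ?_
  have h1 := (hzp n).ne'
  have h2 := (hTp n).ne'
  have h3 := (hTp (n + 1)).ne'
  have h4 : s n ≠ 0 := (hκ.trans_le (hsκ n)).ne'
  simp only [hs] at h4 ⊢
  field_simp
  ring

end Growth

/-! ### Strict slopes of `C¹` maps and the contraction argument. -/

section Contraction

open Filter Topology Asymptotics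

/-- The mean value inequality for `x ↦ g x - D x` on a small interval around `c`, where continuity
makes the derivative close to `D`. Intersecting with `[0,1]` keeps the set convex and includes the
endpoints. -/
theorem IsC1Map.hasStrictSlopeAt {f : unitInterval → unitInterval} (hf : IsC1Map f)
    (c : unitInterval) : ∃ D, HasStrictSlopeAt f c D := by
  set g : ℝ → ℝ := fun x => (f (Set.projIcc 0 1 zero_le_one x) : ℝ) with hg
  have hfg : ∀ y : unitInterval, (f y : ℝ) = g y := fun y => by
    simp only [hg, Set.projIcc_val]
  have hC : ContDiffOn ℝ 1 g (Set.Icc 0 1) := hf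
  have hdiff : ∀ x ∈ Set.Icc (0 : ℝ) 1,
      HasDerivWithinAt g (derivWithin g (Set.Icc 0 1) x) (Set.Icc 0 1) x := fun x hx =>
    (hC.differentiableOn one_ne_zero x hx).hasDerivWithinAt
  have hcd : ContinuousOn (derivWithin g (Set.Icc 0 1)) (Set.Icc 0 1) :=
    hC.continuousOn_derivWithin (uniqueDiffOn_Icc zero_lt_one) le_rfl
  refine ⟨derivWithin g (Set.Icc 0 1) c, ?_⟩
  set D := derivWithin g (Set.Icc 0 1) c with hD
  rw [HasStrictSlopeAt, isLittleO_iff]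
  intro ε hε
  obtain ⟨η, hη, hball⟩ := Metric.continuousOn_iff.1 hcd c c.2 ε hε
  have hev : ∀ᶠ y : unitInterval in 𝓝 c, dist (y : ℝ) c < η := by
    have : Tendsto (fun y : unitInterval => dist (y : ℝ) c) (𝓝 c) (𝓝 0) := by
      have h : Continuous fun y : unitInterval => dist (y : ℝ) c := by fun_prop
      simpa using h.tendsto c
    exact this.eventually_lt_const hη
  rw [nhds_prod_eq]
  filter_upwards [hev.prod_mk hev] with p hp
  have hmv := Convex.norm_image_sub_le_of_norm_hasDerivWithin_le
    (f := fun x => g x - D * x) (f' := fun x => derivWithin g (Set.Icc 0 1) x - D)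
    (s := Metric.ball (c : ℝ) η ∩ Set.Icc 0 1) (C := ε) (x := p.2) (y := p.1)
    (fun x hx => ((hdiff x hx.2).mono Set.inter_subset_right).sub
      (by simpa using (hasDerivWithinAt_id x _).const_mul D))
    (fun x hx => (hball x hx.2 hx.1).le)
    ((convex_ball _ _).inter (convex_Icc _ _)) ⟨hp.2, p.2.2⟩ ⟨hp.1, p.1.2⟩
  rw [hfg, hfg]
  refine le_trans (le_of_eq ?_) hmv
  congr 1
  ring

/-- The derivative at a point which is a limit of fixed points is `1`. -/
theorem HasStrictSlopeAt.eq_one_of_fixed {f : unitInterval → unitInterval} {c : unitInterval}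
    {D : ℝ} (hf : HasStrictSlopeAt f c D) (hc : f c = c) {w : ℕ → unitInterval}
    (hw : Tendsto w atTop (𝓝 c)) (hne : ∀ n, w n ≠ c) (hfix : ∀ n, f (w n) = w n) : D = 1 := by
  have ht : Tendsto (fun n => (w n, c)) atTop (𝓝 (c, c)) := by
    rw [nhds_prod_eq]
    exact hw.prodMk tendsto_const_nhds
  have h := (hf.comp_tendsto ht).tendsto_div_nhds_zero
  have h1 : Tendsto (fun _ : ℕ => 1 - D) atTop (𝓝 0) := by
    refine h.congr fun n => ?_
    have hn : (w n : ℝ) - c ≠ 0 := sub_ne_zero.2 fun h => hne n (Subtype.ext h)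
    simp only [Function.comp, hfix, hc]
    field_simp
  have := tendsto_nhds_unique h1 tendsto_const_nhds
  linarith

/-- A strictly increasing map whose inverse is strictly differentiable has positive derivative. -/
theorem HasStrictSlopeAt.pos {f : unitInterval ≃ₜ unitInterval} (hm : StrictMono f)
    {c : unitInterval} (hc : f c = c) {D D' : ℝ} (hf : HasStrictSlopeAt f c D)
    (hf' : HasStrictSlopeAt f.symm c D') {w : ℕ → unitInterval}
    (hw : Tendsto w atTop (𝓝 c)) (hne : ∀ n, w n ≠ c) : 0 < D := by
  have hsub : ∀ n, (w n : ℝ) - c ≠ 0 := fun n => sub_ne_zero.2 fun h => hne n (Subtype.ext h)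
  have ht : Tendsto (fun n => (w n, c)) atTop (𝓝 (c, c)) := by
    rw [nhds_prod_eq]
    exact hw.prodMk tendsto_const_nhds
  have hlim : Tendsto (fun n => ((f (w n) : ℝ) - c) / (w n - c)) atTop (𝓝 D) := by
    have h := ((hf.comp_tendsto ht).tendsto_div_nhds_zero).add_const D
    rw [zero_add] at h
    refine h.congr fun n => ?_
    have hn := hsub n
    simp only [Function.comp, hc]
    field_simp
    ring
  have hsc : f.symm c = c := by rw [Homeomorph.symm_apply_eq, hc]
  have hfw : Tendsto (fun n => f (w n)) atTop (𝓝 c) := by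
    have := (f.continuous.tendsto c).comp hw
    rwa [hc] at this
  have hne' : ∀ n, f (w n) ≠ c := fun n h => hne n (f.injective (h.trans hc.symm))
  have hsub' : ∀ n, (f (w n) : ℝ) - c ≠ 0 := fun n =>
    sub_ne_zero.2 fun h => hne' n (Subtype.ext h)
  have ht' : Tendsto (fun n => (f (w n), c)) atTop (𝓝 (c, c)) := by
    rw [nhds_prod_eq]
    exact hfw.prodMk tendsto_const_nhds
  have hlim' : Tendsto (fun n => ((w n : ℝ) - c) / (f (w n) - c)) atTop (𝓝 D') := by
    have h := ((hf'.comp_tendsto ht').tendsto_div_nhds_zero).add_const D'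
    rw [zero_add] at h
    refine h.congr fun n => ?_
    have hn := hsub' n
    simp only [Function.comp, hsc, Homeomorph.symm_apply_apply]
    field_simp
    ring
  -- The difference quotients of `f` and its inverse along `w` are reciprocal; monotonicity then
  -- selects the sign.
  have hprod : D * D' = 1 := by
    refine tendsto_nhds_unique (hlim.mul hlim') (tendsto_const_nhds.congr fun n => ?_)
    have h1 := hsub n
    have h2 := hsub' n
    field_simp
  have hD : 0 ≤ D := by
    refine ge_of_tendsto' hlim fun n => ?_
    rcases lt_or_gt_of_ne (hne n) with h | h
    · have h1 : (w n : ℝ) < c := h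
      have h2 : (f (w n) : ℝ) < c := by
        have := hm h
        rwa [hc] at this
      exact div_nonneg_of_nonpos (by linarith) (by linarith)
    · have h1 : (c : ℝ) < w n := h
      have h2 : (c : ℝ) < f (w n) := by
        have := hm h
        rwa [hc] at this
      exact div_nonneg (by linarith) (by linarith)
  exact lt_of_le_of_ne hD fun h => by rw [← h] at hprod; simp at hprod

/-- A map contracting an `H`-invariant interval towards a common fixed point `c` and acting on `H`
by `C` forces the translation functional `t` of the interval to have a subexponential orbit. -/
theorem subexponential_of_contraction {d : ℕ} {H : AddSubgroup (Fin d → ℚ)}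
    {ρ : H → unitInterval → unitInterval} {c : unitInterval}
    (hzero : ∀ y, ρ 0 y = y) (hadd : ∀ h k y, ρ (h + k) y = ρ h (ρ k y))
    (hcont : ∀ h, Continuous (ρ h)) (hmono : ∀ h, StrictMono (ρ h))
    (hslope : ∀ h, ∃ D, HasStrictSlopeAt (ρ h) c D)
    {M : ℕ} (hM : 0 < M) {e : Fin d → H} (he : ∀ i, (e i : Fin d → ℚ) = Pi.single i (M : ℚ))
    {α : unitInterval → unitInterval} (hαm : StrictMono α) {lam : ℝ} (hlam : 0 < lam)
    (hα : HasStrictSlopeAt α c lam)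
    {C : GL (Fin d) ℚ} {γ : H → H}
    (hγ : ∀ h, (γ h : Fin d → ℚ) = (C : Matrix (Fin d) (Fin d) ℚ) *ᵥ h)
    (hconj : ∀ h y, α (ρ (γ h) y) = ρ h (α y))
    {u x v : unitInterval} (hux : u < x) (hxv : x < v) (hu : ∀ h, ρ h u = u) (hv : ∀ h, ρ h v = v)
    (hαu : Tendsto (fun n => α^[n] u) atTop (𝓝 c)) (hαx : Tendsto (fun n => α^[n] x) atTop (𝓝 c))
    (hαv : Tendsto (fun n => α^[n] v) atTop (𝓝 c)) (hne : ∀ n, α^[n] u ≠ c)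
    {t : Fin d → ℝ} (ht : t ≠ 0) (hpos : ∀ h : H, 0 < ratPairing h t → x < ρ h x)
    {r : ℝ} (hr : 1 < r) :
    ∃ K, ∀ n : ℕ,
      ‖t ᵥ* ((C : Matrix (Fin d) (Fin d) ℚ).map (algebraMap ℚ ℝ)) ^ n‖ ≤ K * r ^ n := by
  set R := (C : Matrix (Fin d) (Fin d) ℚ).map (algebraMap ℚ ℝ) with hR
  set δ := displacementVec ρ M e with hδ
  have hM' : (0 : ℝ) < M := by exact_mod_cast hM
  have hαn : ∀ n, StrictMono α^[n] := fun n => hαm.iterate n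
  -- At the `n`-th image, `h` acts as `γ^[n] h` does on the original interval; hence the functional
  -- there is `t` times `Rⁿ`.
  have hconjn : ∀ n h y, α^[n] (ρ (γ^[n] h) y) = ρ h (α^[n] y) := by
    intro n
    induction n with
    | zero => intro h y; rfl
    | succ n ih =>
      intro h y
      rw [Function.iterate_succ_apply, Function.iterate_succ_apply', hconj, ih,
        ← Function.iterate_succ_apply α]
  have hfixn : ∀ w, (∀ h, ρ h w = w) → ∀ n h, ρ h (α^[n] w) = α^[n] w := fun w hw n h => by
    rw [← hconjn, hw]
  have hc : ∀ h, ρ h c = c := fun h =>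
    tendsto_nhds_unique ((((hcont h).tendsto c).comp hαu).congr fun n => hfixn u hu n h) hαu
  have hs : ∀ h, HasStrictSlopeAt (ρ h) c 1 := fun h => by
    obtain ⟨D, hD⟩ := hslope h
    have := hD.eq_one_of_fixed (hc h) hαu hne fun n => hfixn u hu n h
    rwa [this] at hD
  have hlin := displacement_sub_ratPairing_isLittleO hzero hadd hcont hc hs hM he
  have htrans := displacementVec_conj_isLittleO hcont hc hM he hlin hα hγ hconj
  -- the orbit of the translation functional
  set T : ℕ → Fin d → ℝ := fun n => t ᵥ* R ^ n with hTdef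
  have hTs : ∀ n, T (n + 1) = T n ᵥ* R := fun n => by
    simp only [hTdef, pow_succ, Matrix.vecMul_vecMul]
  set S := ((C⁻¹ : GL (Fin d) ℚ) : Matrix (Fin d) (Fin d) ℚ).map (algebraMap ℚ ℝ) with hS
  have hRS : R * S = 1 := by
    rw [hR, hS, ← Matrix.map_mul]
    simp
  have hinj : ∀ w : Fin d → ℝ, w ᵥ* R = 0 → w = 0 := fun w hw => by
    have := congrArg (· ᵥ* S) hw
    simpa [Matrix.vecMul_vecMul, hRS] using this
  have hT : ∀ n, T n ≠ 0 := by
    intro n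
    induction n with
    | zero => simpa [hTdef] using ht
    | succ n ih => exact fun h => ih (hinj _ ((hTs n).symm.trans h))
  have hpair : ∀ n (h : H), ratPairing (γ^[n] h) t = ratPairing h (T n) := by
    intro n
    induction n with
    | zero => intro h; simp [hTdef]
    | succ n ih =>
      intro h
      rw [Function.iterate_succ_apply, ih, hγ, ratPairing_mulVec, ← hTs]
  set y : ℕ → unitInterval := fun n => α^[n] x with hy
  have hposn : ∀ n (h : H), 0 < ratPairing h (T n) → 0 < displacement (ρ h) (y n) := by
    intro n h hh
    rw [← hpair] at hh
    have h1 := hαn n (hpos _ hh)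
    rw [hconjn] at h1
    exact sub_pos.2 h1
  -- Some coordinate of `T n` is nonzero, and then `e i` or `-e i` strictly moves `y n`.
  have hz : ∀ n, δ (y n) ≠ 0 := by
    intro n h0
    obtain ⟨i, hi⟩ := Function.ne_iff.1 (hT n)
    have hfix : ρ (e i) (y n) = y n := by
      have := congrFun h0 i
      simp only [hδ, displacementVec, Pi.zero_apply, div_eq_zero_iff, hM'.ne', or_false,
        displacement, sub_eq_zero] at this
      exact Subtype.ext this
    have hfix' : ρ (-e i) (y n) = y n := by
      conv_lhs => rw [← hfix]
      rw [← hadd, neg_add_cancel, hzero]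
    have hval : ratPairing (e i : Fin d → ℚ) (T n) = M * T n i := by
      rw [he, ratPairing_single]; simp
    rcases lt_or_gt_of_ne hi with h | h
    · have := hposn n (-e i) (by
        rw [AddSubgroup.coe_neg, ratPairing_neg, hval]
        have := mul_pos_of_neg_of_neg (neg_neg_of_pos hM') h
        linarith)
      simp [displacement, hfix'] at this
    · have := hposn n (e i) (by rw [hval]; exact mul_pos hM' h)
      simp [displacement, hfix] at this
  have hzn : ∀ n, 0 < ‖δ (y n)‖ := fun n => norm_pos_iff.2 (hz n)
  have hTn : ∀ n, 0 < ‖T n‖ := fun n => norm_pos_iff.2 (hT n)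
  have hdir : Tendsto (fun n => ‖δ (y n)‖⁻¹ • δ (y n) - ‖T n‖⁻¹ • T n) atTop (𝓝 0) := by
    refine tendsto_sub_of_ratPairing (fun n => ?_) (fun n => ?_) fun p => ?_
    · rw [norm_smul, norm_inv, norm_norm, inv_mul_cancel₀ (hzn n).ne']
    · rw [norm_smul, norm_inv, norm_norm, inv_mul_cancel₀ (hTn n).ne']
    -- Clearing denominators realises `p` by an element `h` of `H`. If `p` is positive on `T n`,
    -- then `h` has positive displacement at `y n`, and `ε` is the normalised linearisation error.
    · obtain ⟨N, hN, h, hh⟩ : ∃ N : ℕ, 0 < N ∧ ∃ h : H, (h : Fin d → ℚ) = N • p := by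
        obtain ⟨N, hN, z, hNz⟩ := exists_nsmul_eq_sum_zsmul hM he p
        exact ⟨N, hN, _, hNz.symm⟩
      have hN' : (0 : ℝ) < N := by exact_mod_cast hN
      have hlim := (((hlin h).comp_tendsto hαx).norm_norm.tendsto_div_nhds_zero).div_const (N : ℝ)
      rw [zero_div] at hlim
      refine ⟨_, hlim, fun n hn => ?_⟩
      have h1 : 0 < displacement (ρ h) (y n) := by
        refine hposn n h ?_
        rw [hh, ratPairing_nsmul]
        refine mul_pos hN' ?_
        rw [ratPairing_smul_right] at hn
        exact pos_of_mul_pos_right hn (by positivity)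
      simp only [Function.comp]
      rw [ratPairing_smul_right, neg_le_iff_add_nonneg, hh, ratPairing_nsmul]
      have h2 := neg_abs_le (displacement (ρ h) (y n) - N * ratPairing p (δ (y n)))
      have h3 := le_abs_self (displacement (ρ h) (y n) - N * ratPairing p (δ (y n)))
      rw [Real.norm_eq_abs]
      have h4 : 0 ≤ ((N : ℝ) * ratPairing p (δ (y n)) +
          |displacement (ρ h) (y n) - N * ratPairing p (δ (y n))|) / (‖δ (y n)‖ * N) :=
        div_nonneg (by linarith) (by positivity)
      refine h4.trans (le_of_eq ?_)
      have := (hzn n).ne'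
      change _ = ‖δ (y n)‖⁻¹ * ratPairing p (δ (y n)) +
        |displacement (ρ h) (y n) - N * ratPairing p (δ (y n))| / ‖δ (y n)‖ / N
      field_simp
  -- comparison of the two orbits
  let Λ : (Fin d → ℝ) →L[ℝ] (Fin d → ℝ) := LinearMap.toContinuousLinearMap (Matrix.toLin' Rᵀ)
  have hΛ : ∀ w, Λ w = w ᵥ* R := fun w => by simp [Λ, Matrix.mulVec_transpose]
  obtain ⟨K, hK, hanti⟩ := LinearMap.exists_antilipschitzWith (Matrix.toLin' Rᵀ)
    (LinearMap.ker_eq_bot'.2 fun w hw => hinj w (by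
      rwa [Matrix.toLin'_apply, Matrix.mulVec_transpose] at hw))
  have hK' : (0 : ℝ) < K := by exact_mod_cast hK
  have hlow : ∀ w, (K : ℝ)⁻¹ * ‖w‖ ≤ ‖Λ w‖ := fun w => by
    rw [inv_mul_le_iff₀ hK']
    have h := hanti.le_mul_dist w 0
    rw [map_zero, dist_zero_right, dist_zero_right] at h
    exact h
  have hratio := tendsto_norm_ratio (inv_pos.2 hK') hlow hlam.le hz hT
    (fun n => by rw [hΛ, hTs]) (by
      refine (htrans.comp_tendsto hαx).congr_left fun n => ?_
      simp only [Function.comp, hΛ, hy, Function.iterate_succ_apply', hδ, hR]) hdir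
  -- lengths of the intervals
  set L : ℕ → ℝ := fun n => (α^[n] v : ℝ) - α^[n] u with hL
  have hLpos : ∀ n, 0 < L n := fun n => sub_pos.2 (hαn n (hux.trans hxv))
  have hLratio : Tendsto (fun n => L (n + 1) / L n) atTop (𝓝 lam) := by
    have htt : Tendsto (fun n => (α^[n] v, α^[n] u)) atTop (𝓝 (c, c)) := by
      rw [nhds_prod_eq]
      exact hαv.prodMk hαu
    have h := ((hα.comp_tendsto htt).tendsto_div_nhds_zero).add_const lam
    rw [zero_add] at h
    refine h.congr fun n => ?_
    have hn := (hLpos n).ne'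
    simp only [hL] at hn
    simp only [Function.comp, hL, Function.iterate_succ_apply']
    field_simp
    ring
  -- `H` fixes both ends of the `n`-th interval, so no point inside is displaced by more than its
  -- length.
  have hδL : ∀ n, ‖δ (y n)‖ ≤ L n / M := by
    intro n
    refine (pi_norm_le_iff_of_nonneg (div_nonneg (hLpos n).le hM'.le)).2 fun i => ?_
    have h1 := hαn n hux
    have h2 := hαn n hxv
    have h3 := hmono (e i) h1
    have h4 := hmono (e i) h2
    rw [hfixn u hu] at h3
    rw [hfixn v hv] at h4
    have h1' : (α^[n] u : ℝ) < α^[n] x := h1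
    have h2' : (α^[n] x : ℝ) < α^[n] v := h2
    have h3' : (α^[n] u : ℝ) < ρ (e i) (α^[n] x) := h3
    have h4' : (ρ (e i) (α^[n] x) : ℝ) < α^[n] v := h4
    simp only [hδ, displacementVec, displacement, hy, hL, norm_div, Real.norm_eq_abs,
      Nat.abs_cast]
    refine div_le_div_of_nonneg_right (abs_le.2 ⟨?_, ?_⟩) hM'.le <;> linarith
  -- The two factors `lam` cancel, so the conclusion does not depend on the derivative of `α` at
  -- `c`.
  have hKratio : Tendsto (fun n => (L (n + 1) / (‖δ (y (n + 1))‖ / ‖T (n + 1)‖)) /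
      (L n / (‖δ (y n)‖ / ‖T n‖))) atTop (𝓝 1) := by
    have h := hLratio.div hratio hlam.ne'
    rw [div_self hlam.ne'] at h
    refine h.congr fun n => ?_
    exact div_div_div_comm _ _ _ _
  obtain ⟨B, hB⟩ := exists_le_mul_pow_of_tendsto_ratio
    (K := fun n => L n / (‖δ (y n)‖ / ‖T n‖))
    (fun n => div_pos (hLpos n) (div_pos (hzn n) (hTn n))) hKratio hr
  refine ⟨B, fun n => ?_⟩
  refine le_trans ?_ (hB n)
  rw [le_div_iff₀ (div_pos (hzn n) (hTn n)), mul_div_cancel₀ _ (hTn n).ne']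
  refine (hδL n).trans (div_le_self (hLpos n).le ?_)
  exact_mod_cast hM

end Contraction

/-! ### Subgroups of full rank, and abelian actions on the interval. -/

section Interval

open Filter Topology

/-- A rational multiple of every vector of the `ℚ`-span of `H` lies in `H`. -/
theorem exists_nsmul_mem_of_mem_span {V : Type*} [AddCommGroup V] [Module ℚ V]
    {H : AddSubgroup V} {w : V} (hw : w ∈ Submodule.span ℚ (H : Set V)) :
    ∃ N : ℕ, 0 < N ∧ N • w ∈ H := by
  induction hw using Submodule.span_induction with
  | mem x hx => exact ⟨1, one_pos, by simpa using hx⟩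
  | zero => exact ⟨1, one_pos, by simp⟩
  | add x y _ _ hx hy =>
    obtain ⟨N, hN, hNx⟩ := hx
    obtain ⟨K, hK, hKy⟩ := hy
    refine ⟨N * K, Nat.mul_pos hN hK, ?_⟩
    rw [smul_add]
    refine H.add_mem ?_ ?_
    · rw [mul_comm, mul_smul]; exact H.nsmul_mem hNx K
    · rw [mul_smul]; exact H.nsmul_mem hKy N
  | smul q x _ hx =>
    obtain ⟨N, hN, hNx⟩ := hx
    refine ⟨q.den * N, Nat.mul_pos q.den_pos hN, ?_⟩
    have : (q.den * N) • q • x = q.num • N • x := by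
      simp only [← Nat.cast_smul_eq_nsmul ℚ, ← Int.cast_smul_eq_zsmul ℚ, smul_smul]
      congr 1
      push_cast
      rw [← Rat.mul_den_eq_num q]
      ring
    rw [this]
    exact H.zsmul_mem hNx _

/-- One common `M`, the product of the individual multipliers, supplies the vectors `e i` used to
coordinatise `H`. -/
theorem exists_single_mem_of_rankQ_eq {d : ℕ} {H : AddSubgroup (Fin d → ℚ)} (h : rankQ H = d) :
    ∃ M : ℕ, 0 < M ∧ ∀ i, Pi.single i (M : ℚ) ∈ H := by
  have htop : Submodule.span ℚ (H : Set (Fin d → ℚ)) = ⊤ :=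
    Submodule.eq_top_of_finrank_eq (by rw [Module.finrank_fin_fun]; exact h)
  have hN : ∀ i : Fin d, ∃ N : ℕ, 0 < N ∧ N • (Pi.single i 1 : Fin d → ℚ) ∈ H := fun i =>
    exists_nsmul_mem_of_mem_span (by rw [htop]; trivial)
  choose N hN hNH using hN
  refine ⟨∏ i, N i, Finset.prod_pos fun i _ => hN i, fun i => ?_⟩
  obtain ⟨k, hk⟩ := Finset.dvd_prod_of_mem N (Finset.mem_univ i)
  have : (Pi.single i ((∏ i, N i : ℕ) : ℚ) : Fin d → ℚ) = k • N i • Pi.single i 1 := by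
    rw [hk]
    ext j
    rcases eq_or_ne j i with rfl | hj
    · simp [mul_comm]
    · simp [Pi.single_eq_of_ne hj]
  rw [this]
  exact H.nsmul_mem (hNH i) k

/-- An additive homomorphism `H → ℝ` is given by a real vector. -/
theorem exists_eq_ratPairing {d : ℕ} {H : AddSubgroup (Fin d → ℚ)} {M : ℕ} (hM : 0 < M)
    {e : Fin d → H} (he : ∀ i, (e i : Fin d → ℚ) = Pi.single i (M : ℚ)) (τ : H →+ ℝ) :
    ∃ t : Fin d → ℝ, ∀ h : H, τ h = ratPairing h t := by
  have hM' : (M : ℝ) ≠ 0 := by exact_mod_cast hM.ne'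
  let t : Fin d → ℝ := fun i => τ (e i) / M
  let σ : H →+ ℝ := AddMonoidHom.mk' (fun h => ratPairing (h : Fin d → ℚ) t)
    fun h k => by rw [AddSubgroup.coe_add, ratPairing_add]
  have hσe : ∀ i, τ (e i) = σ (e i) := fun i => by
    change _ = ratPairing (e i : Fin d → ℚ) t
    rw [he, ratPairing_single, Rat.cast_natCast, mul_div_cancel₀ _ hM']
  refine ⟨t, fun h => ?_⟩
  obtain ⟨N, hN, z, hz⟩ := exists_nsmul_eq_sum_zsmul hM he (h : Fin d → ℚ)
  have hz' : N • h = ∑ i, z i • e i := Subtype.ext (by rw [AddSubgroup.coe_nsmul, hz])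
  have h1 : N • τ h = N • σ h := by
    rw [← map_nsmul, ← map_nsmul, hz']
    simp only [map_sum, map_zsmul, hσe]
  exact (nsmul_right_injective hN.ne') h1

/-- `ρ` is an action of the additive group `H` on `[0,1]` by increasing homeomorphisms. -/
structure IsIncreasingAction {H : Type*} [AddCommGroup H] (ρ : H → unitInterval → unitInterval) :
    Prop where
  zero : ∀ y, ρ 0 y = y
  add : ∀ h k y, ρ (h + k) y = ρ h (ρ k y)
  cont : ∀ h, Continuous (ρ h)
  mono : ∀ h, StrictMono (ρ h)

namespace IsIncreasingAction

variable {H : Type*} [AddCommGroup H] {ρ : H → unitInterval → unitInterval}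

theorem neg_act (hρ : IsIncreasingAction ρ) (h : H) (y : unitInterval) : ρ (-h) (ρ h y) = y := by
  rw [← hρ.add, neg_add_cancel, hρ.zero]

theorem act_neg (hρ : IsIncreasingAction ρ) (h : H) (y : unitInterval) : ρ h (ρ (-h) y) = y := by
  rw [← hρ.add, add_neg_cancel, hρ.zero]

theorem comm (hρ : IsIncreasingAction ρ) (h k : H) (y : unitInterval) :
    ρ h (ρ k y) = ρ k (ρ h y) := by
  rw [← hρ.add, add_comm, hρ.add]

theorem le_neg_act_iff (hρ : IsIncreasingAction ρ) {h : H} {y z : unitInterval} :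
    z ≤ ρ (-h) y ↔ ρ h z ≤ y := by
  conv_rhs => rw [← hρ.act_neg h y]
  exact (hρ.mono h).le_iff_le.symm

theorem neg_act_le_iff (hρ : IsIncreasingAction ρ) {h : H} {y z : unitInterval} :
    ρ (-h) y ≤ z ↔ y ≤ ρ h z := by
  conv_rhs => rw [← hρ.act_neg h y]
  exact (hρ.mono h).le_iff_le.symm

theorem act_zero (hρ : IsIncreasingAction ρ) (h : H) : ρ h 0 = 0 :=
  le_antisymm (hρ.le_neg_act_iff.1 unitInterval.nonneg') unitInterval.nonneg'

theorem act_one (hρ : IsIncreasingAction ρ) (h : H) : ρ h 1 = 1 :=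
  le_antisymm unitInterval.le_one' (hρ.neg_act_le_iff.1 unitInterval.le_one')

theorem isClosed_fixed (hρ : IsIncreasingAction ρ) (h : H) : IsClosed {y | ρ h y = y} :=
  isClosed_eq (hρ.cont h) continuous_id

/-- The greatest element of a closed set which is stable under `h` and `-h` is fixed by `h`. -/
theorem act_eq_of_isGreatest (hρ : IsIncreasingAction ρ) {h : H} {S : Set unitInterval}
    {m : unitInterval} (hm : IsGreatest S m) (h1 : ρ h m ∈ S) (h2 : ρ (-h) m ∈ S) : ρ h m = m :=
  le_antisymm (hm.2 h1) (hρ.neg_act_le_iff.1 (hm.2 h2))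

theorem act_eq_of_isLeast (hρ : IsIncreasingAction ρ) {h : H} {S : Set unitInterval}
    {m : unitInterval} (hm : IsLeast S m) (h1 : ρ h m ∈ S) (h2 : ρ (-h) m ∈ S) : ρ h m = m :=
  le_antisymm (hρ.le_neg_act_iff.1 (hm.2 h2)) (hm.2 h1)

theorem act_neg_eq_of_act_eq (hρ : IsIncreasingAction ρ) {h : H} {y : unitInterval}
    (hy : ρ h y = y) : ρ (-h) y = y := by
  conv_lhs => rw [← hy]
  exact hρ.neg_act h y

/-- Between a common fixed point of `s` and a fixed point of `h` there is a common fixed point of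
`s` and `h`. -/
theorem exists_common_fixed (hρ : IsIncreasingAction ρ) {s : Set H} {h : H} {p q : unitInterval}
    (hp : ∀ k ∈ s, ρ k p = p) (hq : ρ h q = q) :
    ∃ m ∈ Set.uIcc p q, (∀ k ∈ s, ρ k m = m) ∧ ρ h m = m := by
  have hcl : IsClosed {y | ∀ k ∈ s, ρ k y = y} := by
    simp only [Set.ofPred_forall]
    exact isClosed_biInter fun k _ => hρ.isClosed_fixed k
  have hstab : ∀ g y, (∀ k ∈ s, ρ k y = y) → ∀ k ∈ s, ρ k (ρ g y) = ρ g y :=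
    fun g y hy k hk => by rw [hρ.comm, hy k hk]
  rcases le_total p q with hpq | hpq
  -- `h` preserves the fixed set of `s` by commutativity, and the half-line because it fixes `q`; so
  -- it fixes the extremal point.
  · obtain ⟨m, hm⟩ := (hcl.inter isClosed_Iic : IsClosed (_ ∩ Set.Iic q)).isCompact.exists_isGreatest
      ⟨p, hp, hpq⟩
    refine ⟨m, by rw [Set.uIcc_of_le hpq]; exact ⟨hm.2 ⟨hp, hpq⟩, hm.1.2⟩, hm.1.1, ?_⟩
    refine hρ.act_eq_of_isGreatest hm ⟨hstab _ _ hm.1.1, ?_⟩ ⟨hstab _ _ hm.1.1, ?_⟩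
    · have := (hρ.mono h).monotone hm.1.2
      rwa [hq] at this
    · have := (hρ.mono (-h)).monotone hm.1.2
      rwa [hρ.act_neg_eq_of_act_eq hq] at this
  · obtain ⟨m, hm⟩ := (hcl.inter isClosed_Ici : IsClosed (_ ∩ Set.Ici q)).isCompact.exists_isLeast
      ⟨p, hp, hpq⟩
    refine ⟨m, by rw [Set.uIcc_of_ge hpq]; exact ⟨hm.1.2, hm.2 ⟨hp, hpq⟩⟩, hm.1.1, ?_⟩
    refine hρ.act_eq_of_isLeast hm ⟨hstab _ _ hm.1.1, ?_⟩ ⟨hstab _ _ hm.1.1, ?_⟩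
    · have := (hρ.mono h).monotone hm.1.2
      rwa [hq] at this
    · have := (hρ.mono (-h)).monotone hm.1.2
      rwa [hρ.act_neg_eq_of_act_eq hq] at this

/-- The stabiliser of a point is closed under taking roots. -/
theorem act_eq_of_nsmul_act_eq (hρ : IsIncreasingAction ρ) {h : H} {y : unitInterval} {N : ℕ}
    (hN : 0 < N) (hy : ρ (N • h) y = y) : ρ h y = y := by
  have hit : ∀ n : ℕ, ρ (n • h) y = (ρ h)^[n] y := by
    intro n
    induction n with
    | zero => simp [hρ.zero]
    | succ n ih => rw [succ_nsmul', hρ.add, ih, Function.iterate_succ_apply']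
  by_contra hne
  rcases lt_or_gt_of_ne hne with hlt | hlt
  · have := (hρ.mono h).strictAnti_iterate_of_map_lt hlt hN
    simp only [← hit, zero_smul, hρ.zero, hy, lt_irrefl] at this
  · have := (hρ.mono h).strictMono_iterate_of_lt_map hlt hN
    simp only [← hit, zero_smul, hρ.zero, hy, lt_irrefl] at this

/-- A finite family of elements generating `H` up to roots, each of which has a fixed point in an
interval, has a common fixed point there. -/
theorem exists_global_fixed (hρ : IsIncreasingAction ρ) {ι : Type*} [Fintype ι] {e : ι → H}
    (hgen : ∀ h, ∃ N : ℕ, 0 < N ∧ ∃ z : ι → ℤ, N • h = ∑ i, z i • e i) {u v x : unitInterval}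
    (hx : x ∈ Set.Ioo u v) (hfix : ∀ i, ∃ p ∈ Set.Ioo u v, ρ (e i) p = p) :
    ∃ p ∈ Set.Ioo u v, ∀ h, ρ h p = p := by
  classical
  have hind : ∀ s : Finset ι, ∃ p ∈ Set.Ioo u v, ∀ k ∈ e '' s, ρ k p = p := by
    intro s
    induction s using Finset.induction_on with
    | empty => exact ⟨x, hx, by simp⟩
    | insert i s _ ih =>
      obtain ⟨p, hp, hps⟩ := ih
      obtain ⟨q, hq, hqi⟩ := hfix i
      obtain ⟨m, hm, hms, hmi⟩ := hρ.exists_common_fixed hps hqi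
      refine ⟨m, Set.ordConnected_Ioo.uIcc_subset hp hq hm, ?_⟩
      rw [Finset.coe_insert, Set.image_insert_eq]
      rintro k (rfl | hk)
      · exact hmi
      · exact hms k hk
  obtain ⟨p, hp, hpe⟩ := hind Finset.univ
  refine ⟨p, hp, fun h => ?_⟩
  let P : AddSubgroup H :=
    { carrier := {h | ρ h p = p}
      zero_mem' := hρ.zero p
      add_mem' := fun {h k} hh hk => by
        simp only [Set.mem_ofPred_eq] at hh hk ⊢
        rw [hρ.add, hk, hh]
      neg_mem' := fun hh => hρ.act_neg_eq_of_act_eq hh }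
  obtain ⟨N, hN, z, hz⟩ := hgen h
  refine hρ.act_eq_of_nsmul_act_eq hN ?_
  rw [hz]
  have hmem : ∀ i, e i ∈ P := fun i => hpe _ ⟨i, by simp, rfl⟩
  exact (sum_mem fun i _ => zsmul_mem (hmem i) (z i) : ∑ i, z i • e i ∈ P)

/-- An element without fixed points in `(u,v)` moves points arbitrarily close to `v`. -/
theorem exists_lt_zsmul_act (hρ : IsIncreasingAction ρ) {b : H} {u v x : unitInterval}
    (hx : x ∈ Set.Ioo u v) (hb : ∀ p ∈ Set.Ioo u v, ρ b p ≠ p) {y : unitInterval}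
    (hy : y ∈ Set.Ioo u v) : ∃ n : ℤ, y < ρ (n • b) x := by
  by_contra! hcon
  have hcl : IsClosed {z | ∀ n : ℤ, ρ (n • b) x ≤ z} := by
    simp only [Set.ofPred_forall]
    exact isClosed_iInter fun n => isClosed_Ici
  -- The supremum of a bounded `b`-orbit would be a fixed point of `b` in `(u,v)`.
  obtain ⟨m, hm⟩ := hcl.isCompact.exists_isLeast ⟨y, hcon⟩
  have hxm : x ≤ m := by simpa [hρ.zero] using hm.1 0
  refine hb m ⟨hx.1.trans_le hxm, (hm.2 hcon).trans_lt hy.2⟩ ?_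
  refine hρ.act_eq_of_isLeast hm (fun n => ?_) (fun n => ?_)
  · rw [← hρ.neg_act_le_iff, ← hρ.add, show -b + n • b = (n - 1) • b by
      rw [sub_smul, one_smul, sub_eq_add_neg, add_comm]]
    exact hm.1 _
  · rw [hρ.le_neg_act_iff, ← hρ.add, show b + n • b = (n + 1) • b by
      rw [add_smul, one_smul, add_comm]]
    exact hm.1 _

/-- An element without fixed points in `(u,v)` moves points arbitrarily close to `u`. -/
theorem exists_zsmul_act_lt (hρ : IsIncreasingAction ρ) {b : H} {u v x : unitInterval}
    (hx : x ∈ Set.Ioo u v) (hb : ∀ p ∈ Set.Ioo u v, ρ b p ≠ p) {y : unitInterval}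
    (hy : y ∈ Set.Ioo u v) : ∃ n : ℤ, ρ (n • b) x < y := by
  obtain ⟨n, hn⟩ := hρ.exists_lt_zsmul_act hy hb hx
  refine ⟨-n, not_le.1 fun hle => not_le.2 hn ?_⟩
  rwa [neg_smul, hρ.le_neg_act_iff] at hle

/-- The maximal interval around a point moved by `H` on which `H` has no common fixed point. -/
theorem exists_component (hρ : IsIncreasingAction ρ) {x : unitInterval} {h : H}
    (hx : ρ h x ≠ x) :
    ∃ u v, x ∈ Set.Ioo u v ∧ (∀ k, ρ k u = u) ∧ (∀ k, ρ k v = v) ∧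
      ∀ p ∈ Set.Ioo u v, ¬ ∀ k, ρ k p = p := by
  have hcl : IsClosed {y | ∀ k, ρ k y = y} := by
    simp only [Set.ofPred_forall]
    exact isClosed_iInter fun k => hρ.isClosed_fixed k
  obtain ⟨u, hu⟩ := (hcl.inter isClosed_Iic : IsClosed (_ ∩ Set.Iic x)).isCompact.exists_isGreatest
    ⟨0, hρ.act_zero, unitInterval.nonneg'⟩
  obtain ⟨v, hv⟩ := (hcl.inter isClosed_Ici : IsClosed (_ ∩ Set.Ici x)).isCompact.exists_isLeast
    ⟨1, hρ.act_one, unitInterval.le_one'⟩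
  refine ⟨u, v, ⟨lt_of_le_of_ne hu.1.2 ?_, lt_of_le_of_ne hv.1.2 ?_⟩, hu.1.1, hv.1.1, ?_⟩
  · rintro rfl; exact hx (hu.1.1 h)
  · rintro rfl; exact hx (hv.1.1 h)
  · intro p hp hfix
    rcases le_total p x with hpx | hpx
    · exact not_le.2 hp.1 (hu.2 ⟨hfix, hpx⟩)
    · exact not_le.2 hp.2 (hv.2 ⟨hfix, hpx⟩)

/-- On an interval without common fixed points, `H` has a nontrivial translation functional. -/
theorem exists_translation_functional {d : ℕ} {H : AddSubgroup (Fin d → ℚ)}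
    {ρ : H → unitInterval → unitInterval} (hρ : IsIncreasingAction ρ) {M : ℕ} (hM : 0 < M)
    {e : Fin d → H} (he : ∀ i, (e i : Fin d → ℚ) = Pi.single i (M : ℚ)) {u v x : unitInterval}
    (hx : x ∈ Set.Ioo u v) (hu : ∀ k, ρ k u = u) (hv : ∀ k, ρ k v = v)
    (hnofix : ∀ p ∈ Set.Ioo u v, ¬ ∀ k, ρ k p = p) :
    ∃ t : Fin d → ℝ, t ≠ 0 ∧ ∀ h : H, 0 < ratPairing h t → x < ρ h x := by
  have hgen : ∀ h : H, ∃ N : ℕ, 0 < N ∧ ∃ z : Fin d → ℤ, N • h = ∑ i, z i • e i := fun h => by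
    obtain ⟨N, hN, z, hz⟩ := exists_nsmul_eq_sum_zsmul hM he (h : Fin d → ℚ)
    exact ⟨N, hN, z, Subtype.ext (by rw [AddSubgroup.coe_nsmul, hz])⟩
  -- Finite rank enters here: if each `e i` had a fixed point in the interval, all of `H` would have
  -- a common one.
  obtain ⟨i, hi⟩ : ∃ i, ∀ p ∈ Set.Ioo u v, ρ (e i) p ≠ p := by
    by_contra! hcon
    obtain ⟨p, hp, hfix⟩ := hρ.exists_global_fixed hgen hx hcon
    exact hnofix p hp hfix
  obtain ⟨b, hb, hbx⟩ : ∃ b, (∀ p ∈ Set.Ioo u v, ρ b p ≠ p) ∧ x < ρ b x := by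
    rcases lt_or_gt_of_ne (hi x hx) with hlt | hlt
    · refine ⟨-e i, fun p hp hfix => hi p hp ?_, ?_⟩
      · simpa using hρ.act_neg_eq_of_act_eq hfix
      · exact not_le.1 fun hle => not_le.2 hlt (hρ.neg_act_le_iff.1 hle)
    · exact ⟨e i, hi, hlt⟩
  obtain ⟨τ, hτb, hτ⟩ := exists_translation_hom hρ.zero hρ.add hρ.mono (S := Set.Ioo u v)
    (fun h y hy => ⟨by simpa [hu] using hρ.mono h hy.1, by simpa [hv] using hρ.mono h hy.2⟩) hx hbx
    (fun y hy => hρ.exists_lt_zsmul_act hx hb hy) (fun y hy => hρ.exists_zsmul_act_lt hx hb hy)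
  obtain ⟨t, ht⟩ := exists_eq_ratPairing hM he τ
  refine ⟨t, ?_, fun h hh => hτ h (by rwa [ht]) x hx⟩
  rintro rfl
  rw [ht] at hτb
  simp [ratPairing] at hτb

end IsIncreasingAction

end Interval

/-! ### Dynamics of the generator and assembly of the proof. -/

section Main

open Filter Topology

/-- A homeomorphism normalising the action moves a common fixed point monotonically; without common
fixed points in `(0,1)`, all orbits in `(0,1)` converge to the endpoints. -/
theorem tendsto_iterate_of_no_common_fixed {H : Type*} [AddCommGroup H]
    {ρ : H → unitInterval → unitInterval} (hρ : IsIncreasingAction ρ)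
    {α : unitInterval ≃ₜ unitInterval} (hαm : StrictMono α) {γ : H → H}
    (hconj : ∀ h y, α.symm (ρ (γ h) y) = ρ h (α.symm y))
    {γ' : H → H} (hconj' : ∀ h y, α (ρ (γ' h) y) = ρ h (α y))
    (hnofix : ∀ x ∈ Set.Ioo (0 : unitInterval) 1, (∀ h, ρ h x = x) → α x ≠ x)
    {x : unitInterval} (hx : x ∈ Set.Ioo (0 : unitInterval) 1) (hfix : ∀ h, ρ h x = x)
    (hαx : x < α x) {y : unitInterval} (hy : y ∈ Set.Ioo (0 : unitInterval) 1) :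
    Tendsto (fun n => α^[n] y) atTop (𝓝 1) ∧ Tendsto (fun n => α.symm^[n] y) atTop (𝓝 0) := by
  have hsm : StrictMono α.symm := fun a b hab => by
    rw [← hαm.lt_iff_lt]; simpa using hab
  have hle : ∀ a b, α.symm a ≤ b ↔ a ≤ α b := fun a b => by
    rw [← hαm.le_iff_le]; simp
  have hle' : ∀ a b, a ≤ α.symm b ↔ α a ≤ b := fun a b => by
    rw [← hαm.le_iff_le]; simp
  have hfix1 : ∀ n h, ρ h (α^[n] x) = α^[n] x := by
    intro n
    induction n with
    | zero => exact hfix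
    | succ n ih => intro h; rw [Function.iterate_succ_apply', ← hconj', ih]
  have hfix2 : ∀ n h, ρ h (α.symm^[n] x) = α.symm^[n] x := by
    intro n
    induction n with
    | zero => exact hfix
    | succ n ih => intro h; rw [Function.iterate_succ_apply', ← hconj, ih]
  have hup : Monotone fun n => α^[n] x := hαm.monotone.monotone_iterate_of_le_map hαx.le
  have hdown : Antitone fun n => α.symm^[n] x :=
    hsm.monotone.antitone_iterate_of_map_le ((hle _ _).2 hαx.le)
  have cof : ∀ z < (1 : unitInterval), ∃ n, z < α^[n] x := by
    intro z hz
    by_contra! hcon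
    have hcl : IsClosed {z | ∀ n, α^[n] x ≤ z} := by
      simp only [Set.ofPred_forall]
      exact isClosed_iInter fun n => isClosed_Ici
    -- The supremum of the orbit is fixed by `H` and by `α`, against `hnofix`.
    obtain ⟨m, hm⟩ := hcl.isCompact.exists_isLeast ⟨z, hcon⟩
    have hstab : ∀ h, ρ h m ∈ {z | ∀ n, α^[n] x ≤ z} := fun h n => by
      rw [← hfix1 n h]
      exact (hρ.mono h).monotone (hm.1 n)
    refine hnofix m ⟨hx.1.trans_le (hm.1 0), (hm.2 hcon).trans_lt hz⟩
      (fun h => hρ.act_eq_of_isLeast hm (hstab h) (hstab (-h))) (le_antisymm ?_ ?_)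
    · rw [← hle']
      refine hm.2 fun n => (hle' _ _).2 ?_
      have := hm.1 (n + 1)
      rwa [Function.iterate_succ_apply'] at this
    · exact hm.2 fun n => (hup (Nat.le_succ n)).trans (by
        simp only [Function.iterate_succ_apply']
        exact hαm.monotone (hm.1 n))
  have coi : ∀ z, 0 < z → ∃ n, α.symm^[n] x < z := by
    intro z hz
    by_contra! hcon
    have hcl : IsClosed {z | ∀ n, z ≤ α.symm^[n] x} := by
      simp only [Set.ofPred_forall]
      exact isClosed_iInter fun n => isClosed_Iic
    obtain ⟨m, hm⟩ := hcl.isCompact.exists_isGreatest ⟨z, hcon⟩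
    have hstab : ∀ h, ρ h m ∈ {z | ∀ n, z ≤ α.symm^[n] x} := fun h n => by
      rw [← hfix2 n h]
      exact (hρ.mono h).monotone (hm.1 n)
    refine hnofix m ⟨hz.trans_le (hm.2 hcon), (hm.1 0).trans_lt hx.2⟩
      (fun h => hρ.act_eq_of_isGreatest hm (hstab h) (hstab (-h))) (le_antisymm ?_ ?_)
    · refine hm.2 fun n => ?_
      rw [← hle']
      have := hm.1 (n + 1)
      rwa [Function.iterate_succ_apply'] at this
    · rw [← hle]
      exact hm.2 fun n => le_trans (by
        simp only [Function.iterate_succ_apply']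
        exact hsm.monotone (hm.1 n)) (hdown (Nat.le_succ n))
  have hinv : ∀ n a, α^[n] (α.symm^[n] a) = a := fun n a =>
    Function.LeftInverse.iterate (fun a => α.apply_symm_apply a) n a
  have hinv' : ∀ n a, α.symm^[n] (α^[n] a) = a := fun n a =>
    Function.LeftInverse.iterate (fun a => α.symm_apply_apply a) n a
  constructor
  · refine tendsto_order.2 ⟨fun z hz => ?_, fun z hz => absurd unitInterval.le_one' (not_le.2 hz)⟩
    obtain ⟨N, hN⟩ := cof z hz
    obtain ⟨k, hk⟩ := coi y hy.1
    filter_upwards [eventually_ge_atTop (N + k)] with n hn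
    obtain ⟨m, rfl⟩ := Nat.exists_eq_add_of_le hn
    have h1 := (hαm.iterate k) hk
    rw [hinv] at h1
    calc z < α^[N] x := hN
      _ ≤ α^[N + m] x := hup (Nat.le_add_right N m)
      _ ≤ α^[N + m] (α^[k] y) := (hαm.iterate _).monotone h1.le
      _ = α^[N + k + m] y := by rw [← Function.iterate_add_apply, Nat.add_right_comm]
  · refine tendsto_order.2 ⟨fun z hz => absurd unitInterval.nonneg' (not_le.2 hz), fun z hz => ?_⟩
    obtain ⟨N, hN⟩ := coi z hz
    obtain ⟨k, hk⟩ := cof y hy.2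
    filter_upwards [eventually_ge_atTop (N + k)] with n hn
    obtain ⟨m, rfl⟩ := Nat.exists_eq_add_of_le hn
    have h1 := (hsm.iterate k) hk
    rw [hinv'] at h1
    calc α.symm^[N + k + m] y = α.symm^[N + m] (α.symm^[k] y) := by
          rw [← Function.iterate_add_apply, Nat.add_right_comm]
      _ ≤ α.symm^[N + m] x := (hsm.iterate _).monotone h1.le
      _ ≤ α.symm^[N] x := hdown (Nat.le_add_right N m)
      _ < z := hN

/-- For a `C¹` action of `ℤ ⋉_B H` on `[0,1]` in which `H` is nontrivial and has a common fixed point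
moved to the right by the generator, there is a nonzero row vector whose orbit under `B` grows
subexponentially in both directions. -/
theorem exists_subexponential_vector {d : ℕ} {H : AddSubgroup (Fin d → ℚ)}
    {ρ : H → unitInterval → unitInterval} (hρ : IsIncreasingAction ρ)
    (hslope : ∀ h c, ∃ D, HasStrictSlopeAt (ρ h) c D)
    {M : ℕ} (hM : 0 < M) {e : Fin d → H} (he : ∀ i, (e i : Fin d → ℚ) = Pi.single i (M : ℚ))
    {α : unitInterval ≃ₜ unitInterval} (hαm : StrictMono α)
    (hα : ∀ c, ∃ D, HasStrictSlopeAt α c D) (hα' : ∀ c, ∃ D, HasStrictSlopeAt α.symm c D)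
    {B : GL (Fin d) ℚ} {γ γ' : H → H}
    (hγ : ∀ h, (γ h : Fin d → ℚ) = (B : Matrix (Fin d) (Fin d) ℚ) *ᵥ h)
    (hγ' : ∀ h, (γ' h : Fin d → ℚ) = ((B⁻¹ : GL (Fin d) ℚ) : Matrix (Fin d) (Fin d) ℚ) *ᵥ h)
    (hconj : ∀ h y, α (ρ h y) = ρ (γ h) (α y))
    (hnofix : ∀ x ∈ Set.Ioo (0 : unitInterval) 1, (∀ h, ρ h x = x) → α x ≠ x)
    (hnontriv : ∃ h y, ρ h y ≠ y)
    {x₀ : unitInterval} (hx₀ : x₀ ∈ Set.Ioo (0 : unitInterval) 1) (hfix : ∀ h, ρ h x₀ = x₀)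
    (hαx : x₀ < α x₀) :
    ∃ t : Fin d → ℝ, t ≠ 0 ∧ ∀ r : ℝ, 1 < r →
      (∃ K, ∀ n : ℕ,
        ‖t ᵥ* ((B : Matrix (Fin d) (Fin d) ℚ).map (algebraMap ℚ ℝ)) ^ n‖ ≤ K * r ^ n) ∧
      ∃ K, ∀ n : ℕ,
        ‖t ᵥ* (((B⁻¹ : GL (Fin d) ℚ) : Matrix (Fin d) (Fin d) ℚ).map (algebraMap ℚ ℝ)) ^ n‖
          ≤ K * r ^ n := by
  have hsm : StrictMono α.symm := fun a b hab => by
    rw [← hαm.lt_iff_lt]; simpa using hab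
  have hα0 : α 0 = 0 := le_antisymm
    (by simpa using hαm.monotone (unitInterval.nonneg' (t := α.symm 0))) unitInterval.nonneg'
  have hα1 : α 1 = 1 := le_antisymm unitInterval.le_one'
    (by simpa using hαm.monotone (unitInterval.le_one' (t := α.symm 1)))
  have hα0' : α.symm 0 = 0 := by rw [Homeomorph.symm_apply_eq, hα0]
  have hα1' : α.symm 1 = 1 := by rw [Homeomorph.symm_apply_eq, hα1]
  have hγγ' : ∀ h, γ (γ' h) = h := fun h => Subtype.ext (by
    rw [hγ, hγ', Matrix.mulVec_mulVec]; simp)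
  have hconj1 : ∀ h y, α (ρ (γ' h) y) = ρ h (α y) := fun h y => by rw [hconj, hγγ']
  have hconj2 : ∀ h y, α.symm (ρ (γ h) y) = ρ h (α.symm y) := fun h y => by
    rw [Homeomorph.symm_apply_eq, hconj, Homeomorph.apply_symm_apply]
  have horb := fun y (hy : y ∈ Set.Ioo (0 : unitInterval) 1) =>
    tendsto_iterate_of_no_common_fixed hρ hαm hconj2 hconj1 hnofix hx₀ hfix hαx hy
  obtain ⟨h₀, x, hx⟩ := hnontriv
  obtain ⟨u, v, hxuv, hu, hv, hcomp⟩ := hρ.exists_component hx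
  have hx01 : x ∈ Set.Ioo (0 : unitInterval) 1 := by
    refine ⟨lt_of_le_of_ne unitInterval.nonneg' ?_, lt_of_le_of_ne unitInterval.le_one' ?_⟩
    · rintro rfl; exact hx (hρ.act_zero _)
    · rintro rfl; exact hx (hρ.act_one _)
  have hfix1 : ∀ n h, ρ h (α^[n] x₀) = α^[n] x₀ := by
    intro n
    induction n with
    | zero => exact hfix
    | succ n ih => intro h; rw [Function.iterate_succ_apply', ← hconj1, ih]
  have hfix2 : ∀ n h, ρ h (α.symm^[n] x₀) = α.symm^[n] x₀ := by
    intro n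
    induction n with
    | zero => exact hfix
    | succ n ih => intro h; rw [Function.iterate_succ_apply', ← hconj2, ih]
  have hα0n : ∀ n, α.symm^[n] 0 = 0 := fun n => Function.iterate_fixed hα0' n
  have hα1n : ∀ n, α^[n] 1 = 1 := fun n => Function.iterate_fixed hα1 n
  -- Backward images of `x₀` are common fixed points tending to `0`, so one of them separates `0`
  -- from the component; likewise forward images at `1`.
  have hu0 : 0 < u := by
    obtain ⟨n, hn⟩ := ((horb x₀ hx₀).2.eventually_lt_const hx01.1).exists
    have h0 : 0 < α.symm^[n] x₀ := by
      have := hsm.iterate n hx₀.1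
      rwa [hα0n] at this
    refine h0.trans_le (not_lt.1 fun hlt => ?_)
    exact hcomp _ ⟨hlt, hn.trans hxuv.2⟩ (hfix2 n)
  have hv1 : v < 1 := by
    obtain ⟨n, hn⟩ := ((horb x₀ hx₀).1.eventually_const_lt hx01.2).exists
    have h0 : α^[n] x₀ < 1 := by
      have := hαm.iterate n hx₀.2
      rwa [hα1n] at this
    refine lt_of_le_of_lt (not_lt.1 fun hlt => ?_) h0
    exact hcomp _ ⟨hxuv.1.trans hn, hlt⟩ (hfix1 n)
  have hu01 : u ∈ Set.Ioo (0 : unitInterval) 1 := ⟨hu0, hxuv.1.trans hx01.2⟩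
  have hv01 : v ∈ Set.Ioo (0 : unitInterval) 1 := ⟨hx01.1.trans hxuv.2, hv1⟩
  obtain ⟨t, ht, hpos⟩ := hρ.exists_translation_functional hM he hxuv hu hv hcomp
  have hne1 : ∀ n, α^[n] u ≠ 1 := fun n => by
    have := hαm.iterate n hu01.2
    rw [hα1n] at this
    exact this.ne
  have hne0 : ∀ n, α.symm^[n] u ≠ 0 := fun n => by
    have := hsm.iterate n hu01.1
    rw [hα0n] at this
    exact this.ne'
  refine ⟨t, ht, fun r hr => ⟨?_, ?_⟩⟩
  -- The inverse of `α` contracts to `0` and yields the orbit under `B`; `α` contracts to `1` and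
  -- yields the orbit under `B⁻¹`, with the same `t`.
  · obtain ⟨D, hD⟩ := hα' 0
    obtain ⟨D', hD'⟩ := hα 0
    exact subexponential_of_contraction hρ.zero hρ.add hρ.cont hρ.mono (fun h => hslope h 0) hM he
      hsm (HasStrictSlopeAt.pos hsm hα0' hD hD' (horb u hu01).2 hne0) hD hγ hconj2 hxuv.1 hxuv.2
      hu hv (horb u hu01).2 (horb x hx01).2 (horb v hv01).2 hne0 ht hpos hr
  · obtain ⟨D, hD⟩ := hα 1
    obtain ⟨D', hD'⟩ := hα' 1
    exact subexponential_of_contraction hρ.zero hρ.add hρ.cont hρ.mono (fun h => hslope h 1) hM he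
      hαm (HasStrictSlopeAt.pos hαm hα1 hD hD' (horb u hu01).1 hne1) hD hγ' hconj1 hxuv.1 hxuv.2
      hu hv (horb u hu01).1 (horb x hx01).1 (horb v hv01).1 hne1 ht hpos hr

/-- The inclusion of `H` into `ℤ ⋉_A H`. -/
def translationElt {d : ℕ} (A : GL (Fin d) ℚ) {H : AddSubgroup (Fin d → ℚ)}
    (hH : IsInvariantUnder A H) (h : H) : semidirectSubgroup A H hH :=
  ⟨SemidirectProduct.inl (.ofAdd (h : Fin d → ℚ)), h.2⟩

/-- The generator of `ℤ` in `ℤ ⋉_A H`. -/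
def generatorElt {d : ℕ} (A : GL (Fin d) ℚ) {H : AddSubgroup (Fin d → ℚ)}
    (hH : IsInvariantUnder A H) : semidirectSubgroup A H hH :=
  ⟨SemidirectProduct.inr (.ofAdd 1), H.zero_mem⟩

/-! ### The relations and normal form of the semidirect product. -/

section Group

variable {d : ℕ} {A : GL (Fin d) ℚ} {H : AddSubgroup (Fin d → ℚ)} (hH : IsInvariantUnder A H)

theorem translationElt_zero : translationElt A hH 0 = 1 := rfl

theorem translationElt_add (h k : H) :
    translationElt A hH (h + k) = translationElt A hH h * translationElt A hH k :=
  Subtype.ext (map_mul SemidirectProduct.inl (Multiplicative.ofAdd (h : Fin d → ℚ))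
    (Multiplicative.ofAdd (k : Fin d → ℚ)))

theorem translationElt_mem (h : H) : translationElt A hH h ∈ abelianPart A H hH :=
  MonoidHom.mem_ker.2 rfl

theorem exists_eq_translationElt {g : semidirectSubgroup A H hH} (hg : g ∈ abelianPart A H hH) :
    ∃ h : H, g = translationElt A hH h :=
  ⟨⟨g.1.left.toAdd, g.2⟩, Subtype.ext (SemidirectProduct.ext rfl (MonoidHom.mem_ker.1 hg))⟩

theorem generatorElt_mul_translationElt {h k : H}
    (hk : (k : Fin d → ℚ) = (A : Matrix (Fin d) (Fin d) ℚ) *ᵥ h) :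
    generatorElt A hH * translationElt A hH h = translationElt A hH k * generatorElt A hH := by
  refine Subtype.ext (SemidirectProduct.ext ?_ ?_)
  · change 1 * zpowersHom _ (matAut A) (.ofAdd 1) (.ofAdd (h : Fin d → ℚ)) =
      .ofAdd (k : Fin d → ℚ) * zpowersHom _ (matAut A) 1 1
    rw [one_mul, zpowersHom_apply, zpowersHom_apply, toAdd_ofAdd, zpow_one, toAdd_one, zpow_zero,
      MulAut.one_apply, mul_one, hk]
    rfl
  · simp [generatorElt, translationElt]

theorem exists_eq_translationElt_mul_zpow (g : semidirectSubgroup A H hH) :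
    ∃ (h : H) (n : ℤ), g = translationElt A hH h * generatorElt A hH ^ n := by
  refine ⟨⟨g.1.left.toAdd, g.2⟩, g.1.right.toAdd, Subtype.ext ?_⟩
  have : ((generatorElt A hH ^ g.1.right.toAdd : semidirectSubgroup A H hH) : AffineQ A)
      = SemidirectProduct.inr g.1.right := by
    rw [Subgroup.coe_zpow]
    simp only [generatorElt]
    rw [← map_zpow, ← ofAdd_zsmul]
    simp
  rw [Subgroup.coe_mul, this]
  exact (SemidirectProduct.inl_left_mul_inr_right g.1).symm

end Group

end Main

theorem mainTheorem11 {d : ℕ} (A : GL (Fin d) ℚ) (hA : NoEigenvalueOfNormOne A)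
    (H : AddSubgroup (Fin d → ℚ)) (hH : IsInvariantUnder A H) (hrank : rankQ H = d)
    (φ : semidirectSubgroup A H hH →* (unitInterval ≃ₜ unitInterval))
    (hmono : ∀ g, StrictMono (φ g))
    (hG : ∀ x ∈ Set.Ioo (0 : unitInterval) 1, ¬ IsGlobalFixedPoint φ ⊤ x)
    (hnontriv : ∃ b ∈ abelianPart A H hH, φ b ≠ 1)
    (hfix : ∃ x ∈ Set.Ioo (0 : unitInterval) 1, IsGlobalFixedPoint φ (abelianPart A H hH) x) :
    ¬ ∀ g, IsC1Diffeo (φ g) := by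
  intro hC1
  let ρ : H → unitInterval → unitInterval := fun h => φ (translationElt A hH h)
  have hρ : IsIncreasingAction ρ :=
    { zero := fun y => by simp only [ρ, translationElt_zero, map_one]; rfl
      add := fun h k y => by simp only [ρ, translationElt_add, map_mul]; rfl
      cont := fun h => (φ _).continuous
      mono := fun h => hmono _ }
  obtain ⟨M, hM, hMH⟩ := exists_single_mem_of_rankQ_eq hrank
  let e : Fin d → H := fun i => ⟨Pi.single i (M : ℚ), hMH i⟩
  obtain ⟨x₀, hx₀, hfix⟩ := hfix
  have hfix₀ : ∀ h, ρ h x₀ = x₀ := fun h => hfix _ (translationElt_mem hH h)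
  have hnontriv' : ∃ h y, ρ h y ≠ y := by
    obtain ⟨b, hb, hb1⟩ := hnontriv
    obtain ⟨h, rfl⟩ := exists_eq_translationElt hH hb
    by_contra! hcon
    exact hb1 (Homeomorph.ext fun y => hcon h y)
  let γ : H → H := fun h => ⟨_, (hH h).2 h.2⟩
  have hinvmem : ∀ h : H,
      ((A⁻¹ : GL (Fin d) ℚ) : Matrix (Fin d) (Fin d) ℚ) *ᵥ (h : Fin d → ℚ) ∈ H := fun h => by
    rw [← hH, Matrix.mulVec_mulVec]
    simp
  let γ' : H → H := fun h => ⟨_, hinvmem h⟩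
  set a := φ (generatorElt A hH) with ha
  have hconj : ∀ h y, a (ρ h y) = ρ (γ h) (a y) := fun h y => by
    have := congrArg φ (generatorElt_mul_translationElt hH (h := h) (k := γ h) rfl)
    rw [map_mul, map_mul] at this
    exact congrArg (fun f : unitInterval ≃ₜ unitInterval => f y) this
  have hconj' : ∀ h y, a.symm (ρ h y) = ρ (γ' h) (a.symm y) := fun h y => by
    rw [Homeomorph.symm_apply_eq, hconj, Homeomorph.apply_symm_apply]
    congr 1
    exact Subtype.ext (by simp [γ, γ', Matrix.mulVec_mulVec])
  have hslope : ∀ h c, ∃ D, HasStrictSlopeAt (ρ h) c D := fun h c =>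
    (hC1 (translationElt A hH h)).1.hasStrictSlopeAt c
  have hnofix : ∀ x ∈ Set.Ioo (0 : unitInterval) 1, (∀ h, ρ h x = x) → a x ≠ x := by
    intro x hx hρx hax
    -- A point fixed by `H` and by the generator is fixed by all of `G`.
    refine hG x hx fun g _ => ?_
    obtain ⟨h, n, rfl⟩ := exists_eq_translationElt_mul_zpow hH g
    let S : Subgroup (unitInterval ≃ₜ unitInterval) :=
      { carrier := {f | f x = x}
        one_mem' := rfl
        mul_mem' := fun {f g} hf hg => (congrArg f hg).trans hf
        inv_mem' := fun {f} hf => (Homeomorph.symm_apply_eq f).2 hf.symm }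
    have hz : (a ^ n) x = x := S.zpow_mem (show a ∈ S from hax) n
    rw [map_mul, map_zpow, Homeomorph.mul_apply, hz]
    exact hρx h
  have hamono : StrictMono a := hmono _
  have hsm : StrictMono a.symm := fun y z hyz => by
    rw [← hamono.lt_iff_lt]; simpa using hyz
  have ha1 : ∀ c, ∃ D, HasStrictSlopeAt a c D := fun c =>
    (hC1 (generatorElt A hH)).1.hasStrictSlopeAt c
  have ha2 : ∀ c, ∃ D, HasStrictSlopeAt a.symm c D := fun c =>
    (hC1 (generatorElt A hH)).2.hasStrictSlopeAt c
  have key : ∃ t : Fin d → ℝ, t ≠ 0 ∧ ∀ r : ℝ, 1 < r →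
      (∃ K, ∀ n : ℕ,
        ‖t ᵥ* ((A : Matrix (Fin d) (Fin d) ℚ).map (algebraMap ℚ ℝ)) ^ n‖ ≤ K * r ^ n) ∧
      ∃ K, ∀ n : ℕ,
        ‖t ᵥ* (((A⁻¹ : GL (Fin d) ℚ) : Matrix (Fin d) (Fin d) ℚ).map (algebraMap ℚ ℝ)) ^ n‖
          ≤ K * r ^ n := by
    -- If the generator moves `x₀` to the left, its inverse is used with `A⁻¹`; the two growth
    -- bounds are merely exchanged.
    rcases lt_or_gt_of_ne (hnofix x₀ hx₀ hfix₀) with hlt | hlt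
    · have hlt' : x₀ < a.symm x₀ := by
        rw [← hamono.lt_iff_lt]; simpa using hlt
      obtain ⟨t, ht, hr⟩ := exists_subexponential_vector hρ hslope hM (e := e) (fun i => rfl) hsm
        ha2 ha1 (B := A⁻¹) (γ := γ') (γ' := γ) (fun h => rfl) (fun h => by rw [inv_inv]) hconj'
        (fun x hx hρx hax => hnofix x hx hρx (by
          conv_lhs => rw [← hax]
          exact a.apply_symm_apply x))
        hnontriv' hx₀ hfix₀ hlt'
      rw [inv_inv] at hr
      exact ⟨t, ht, fun r hr1 => (hr r hr1).symm⟩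
    · exact exists_subexponential_vector hρ hslope hM (e := e) (fun i => rfl) hamono ha1 ha2
        (γ := γ) (γ' := γ') (fun h => rfl) (fun h => rfl) hconj hnofix hnontriv' hx₀ hfix₀ hlt
  obtain ⟨t, ht, hr⟩ := key
  exact ht (eq_zero_of_subexponential_vecMul hA (fun r hr1 => (hr r hr1).1)
    fun r hr1 => (hr r hr1).2)
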